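/- Let $L>0$, $x\in[0,L]$, $u=e^{2\pi i x/L}$. For $N\ge1$ let $$\rho^{\rm C}_N(x;y)=N\int_{[0,L]^{N-1}}\psi_0(x,x_2,\dots,x_N)\,\psi_0(y,x_2,\dots,x_N)\,dx_2\cdots dx_N,\qquad \psi_0(x_1,\dots,x_N)=\frac{1}{\sqrt{L^{N}N!}}\prod_{1\le j<k\le N}2\Big|\sin\frac{\pi(x_k-x_j)}{L}\Big| ,$$ be the density matrix of $N$ impenetrable bosons on a circle of circumference $L$, and abbreviate $\rho^{\rm C}_N=\rho^{\rm C}_N(x;0)$. Let $w(z)=\frac{C}{2\pi}|1+z||1+uz|$ on the unit circle $\mathbb T$, with $C$ chosen so that $\int_{\mathbb T}w(z)\frac{dz}{iz}=1$, and let $\phi_n(z)=\kappa_nz^n+\dots+\phi_n(0)$, $\kappa_n>0$, $n=0,1,2,\dots$, be the polynomials with $\int_{\mathbb T}w(z)\phi_n(z)\overline{\phi_m(z)}\frac{dz}{iz}=\delta_{m,n}$ (they exist and are unique). Put $r_n=\phi_n(0)/\kappa_n$. Then $\rho^{\rm C}_N>0$ for all $N\ge1$, and the following hold. 1. For all $N\ge1$,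 $$1-|r_N|^2=\frac{\rho^{\rm C}_{N+2}\,\rho^{\rm C}_N}{(\rho^{\rm C}_{N+1})^2}.$$ 2. The numbers $\tilde r_n$ defined by $r_n=e^{i\pi(1-x/L)n}\,\tilde r_n$ are real, and $$\tilde r_0=1,\qquad \tilde r_1=\frac14\,\frac{\pi-2\pi x/L+\sin(2\pi x/L)}{\frac12(\pi-2\pi x/L)\cos(\pi x/L)+\sin(\pi x/L)} .$$ 3. For every $N\ge0$ with $\tilde r_N\ne0$ and $\tilde r_{N+1}\neq0$, $$2\cos\frac{\pi x}{L}+2\tilde r_{N+1}\tilde r_N=\frac{1-\tilde r_{N+1}^2}{\tilde r_{N+1}}\big[(N+3)\tilde r_{N+2}+(N+1)\tilde r_N\big]-\frac{1-\tilde r_N^2}{\tilde r_N}\big[(N+2)\tilde r_{N+1}+N\tilde r_{N-1}\big]$$ (for $N=0$ the term $N\tilde r_{N-1}$ is absent), and for every $N\ge0$, whether or not $\tilde r_N$ or $\tilde r_{N+1}$ vanishes, the equation obtained from this one by multiplying by $\tilde r_N\tilde r_{N+1}$ holds. 4. The equation and the initial values determine the $\tilde r_n$: if $\tilde r_n\ne0$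 for all $n\le N$, and a real sequence $(s_n)$ has $s_0=\tilde r_0$, $s_1=\tilde r_1$ and satisfies the multiplied-out equations of indices $0,\dots,N$, then $s_n=\tilde r_n$ for all $n\le N+2$. Moreover each $\tilde r_n$ is a continuous function of $x\in[0,L]$ with only finitely many zeros. 5. Also $$\rho^{\rm C}_1=\frac1L,\qquad \rho^{\rm C}_2=\frac{4}{\pi L}\Big[\pi\Big(\frac12-\frac xL\Big)\cos\frac{\pi x}{L}+\sin\frac{\pi x}{L}\Big],$$ so that $\rho^{\rm C}_{N+2}=(1-\tilde r_N^2)(\rho^{\rm C}_{N+1})^2/\rho^{\rm C}_N$, $N\ge1$, generates the whole sequence recursively. -/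

import Mathlib

open Set Polynomial

noncomputable section

namespace ImpenetrableBose

/-- The ground state wave function of `N` impenetrable bosons on a circle of circumference `L`:
`L^{-N/2} (N!)^{-1/2} ∏_{j<k} 2 |sin (π (x_k - x_j) / L)|`. -/
def psiC (L : ℝ) {N : ℕ} (x : Fin N → ℝ) : ℝ :=
  (Real.sqrt (L ^ N))⁻¹ * (Real.sqrt (N.factorial : ℝ))⁻¹ *
    ∏ j : Fin N, ∏ k ∈ Finset.Ioi j, 2 * |Real.sin (Real.pi * (x k - x j) / L)|

/-- The one-particle density matrix of the `N`-particle ground state on the circle,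
`ρ_N(x; y) = N ∫_{[0,L]^{N-1}} ψ(x, x_2, …, x_N) ψ(y, x_2, …, x_N) dx_2 ⋯ dx_N` for `N ≥ 1`
(with value `0` for `N = 0`). -/
def rhoC (L : ℝ) : ℕ → ℝ → ℝ → ℝ
  | 0, _, _ => 0
  | N + 1, x, y => ((N + 1 : ℕ) : ℝ) *
      ∫ t in Set.univ.pi (fun _ : Fin N => Icc (0 : ℝ) L),
        psiC L (Fin.cons x t : Fin (N + 1) → ℝ) * psiC L (Fin.cons y t : Fin (N + 1) → ℝ)

/-- The integral `∫_𝕋 f(z) dz / (i z)` over the unit circle, that is `∫_0^{2π} f(e^{iθ}) dθ`. -/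
def circleInt {E : Type*} [NormedAddCommGroup E] [NormedSpace ℝ E] (f : ℂ → E) : E :=
  ∫ θ in (0 : ℝ)..(2 * Real.pi), f (Complex.exp (θ * Complex.I))

/-- The unnormalised weight `|1 + z| |1 + u z|`. -/
def bareWeight (u z : ℂ) : ℝ := ‖1 + z‖ * ‖1 + u * z‖

/-- The constant `C` with `C / (2π) ∫_𝕋 |1 + z| |1 + u z| dz / (i z) = 1`. -/
def normConst (u : ℂ) : ℝ := 2 * Real.pi / circleInt (bareWeight u)

/-- The normalised weight `C / (2π) |1 + z| |1 + u z|`. -/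
def weight (u z : ℂ) : ℝ := normConst u / (2 * Real.pi) * bareWeight u z

/-- `φ` is the system of orthonormal polynomials on the unit circle for the weight `w`:
`φ n` has degree exactly `n` and a positive leading coefficient, and
`∫_𝕋 w(z) φ_n(z) conj (φ_m(z)) dz / (i z) = δ_{m,n}`. -/
structure IsOrthonormalSystem (w : ℂ → ℝ) (φ : ℕ → ℂ[X]) : Prop where
  natDegree_eq : ∀ n, (φ n).natDegree = n
  leadingCoeff_pos : ∀ n, ∃ κ : ℝ, 0 < κ ∧ (φ n).leadingCoeff = (κ : ℂ)
  orthonormal : ∀ n m, circleInt (fun z : ℂ =>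
      (w z : ℂ) * (φ n).eval z * (starRingEnd ℂ) ((φ m).eval z)) = if m = n then 1 else 0

/-- The reflection coefficient `r_n = φ_n(0) / κ_n`, where `κ_n` is the leading coefficient. -/
def reflCoeff (φ : ℕ → ℂ[X]) (n : ℕ) : ℂ := (φ n).eval 0 / (φ n).leadingCoeff

/-- The point `u = e^{2π i x / L}` of the unit circle. -/
def circlePoint (L x : ℝ) : ℂ := Complex.exp (2 * Real.pi * Complex.I * x / L)

/-- The third order difference equation at index `N`, with denominators:
`2c + 2 s_{N+1} s_N = (1 - s_{N+1}^2)/s_{N+1} [(N+3) s_{N+2} + (N+1) s_N]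
  - (1 - s_N^2)/s_N [(N+2) s_{N+1} + N s_{N-1}]`.
At `N = 0` the last term is absent because of its factor `N`. -/
def DiffEq (c : ℝ) (s : ℕ → ℝ) (N : ℕ) : Prop :=
  2 * c + 2 * s (N + 1) * s N =
    (1 - s (N + 1) ^ 2) / s (N + 1) * ((N + 3) * s (N + 2) + (N + 1) * s N)
      - (1 - s N ^ 2) / s N * ((N + 2) * s (N + 1) + N * s (N - 1))

/-- The same equation multiplied through by `s_N s_{N+1}`. -/
def DiffEqCleared (c : ℝ) (s : ℕ → ℝ) (N : ℕ) : Prop :=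
  (2 * c + 2 * s (N + 1) * s N) * (s N * s (N + 1)) =
    (1 - s (N + 1) ^ 2) * s N * ((N + 3) * s (N + 2) + (N + 1) * s N)
      - (1 - s N ^ 2) * s (N + 1) * ((N + 2) * s (N + 1) + N * s (N - 1))

/-- The initial value
`(1/4) (π - 2πx/L + sin (2πx/L)) / ((1/2) (π - 2πx/L) cos (πx/L) + sin (πx/L))`. -/
def initOne (L x : ℝ) : ℝ :=
  1 / 4 * ((Real.pi - 2 * Real.pi * x / L + Real.sin (2 * Real.pi * x / L)) /
    (1 / 2 * (Real.pi - 2 * Real.pi * x / L) * Real.cos (Real.pi * x / L)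
      + Real.sin (Real.pi * x / L)))

end ImpenetrableBose

end

open ImpenetrableBose

namespace ImpenetrableBose

/-! Put `α = πx/L` and `c = cos α`. The substitution `z = e^{i(θ + π - α)}` turns the weight into a
multiple of `2|cos θ - c|`. This is even in `θ`, so its Toeplitz form is real, and so are its monic
orthogonal polynomials `S_n`. Undoing the rotation multiplies `S_n(0)` by `e^{iπ(1 - x/L)n}`; hence
`r̃_n = S_n(0)`, called `verblunsky` below. Write `h_n` for the squared norm of `S_n` and `l_n` for
its coefficient of degree `n - 1`.

Density matrices: in `ψ₀(x, t) ψ₀(0, t)` the factors involving `x` or `0` multiply to the weight at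
each particle, and the other factors form `|Vandermonde|²`. Heine's formula gives `ρ_{N+1} = (1/L)
∏_{j<N} h_j/(2π)` (`rhoC_eq`), and `h_{n+1} = (1 - r̃_{n+1}²) h_n` yields the quotient formula.

Difference equation: the weight satisfies a first-order linear differential equation, whose weak
form is integration by parts (`isPearson_cosForm`). Testing it on `S_{n+1}` and its reversal gives a
relation between `r̃_n`, `r̃_{n+1}`, `r̃_{n+2}` and `l_{n+1}` (`verblunsky_pearson`). Since `l_{n+1}
- l_n = r̃_{n+1} r̃_n`, two consecutive relations eliminate `l` and leave the third-order equation.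

Dependence on `x`: the relation with `l` can be solved for `r̃_{n+2}` by dividing only by `1 -
r̃_{n+1}²`, which never vanishes. So each `r̃_n` is analytic in `α` on `[0, π]`. At `α = 0` it
equals `1/(n+1) ≠ 0`, and the identity theorem allows only finitely many zeros. -/

/-- A symmetric positive definite form on real polynomials with Toeplitz Gram matrix. -/
structure IsToeplitzForm (B : ℝ[X] →ₗ[ℝ] ℝ[X] →ₗ[ℝ] ℝ) : Prop where
  symm : ∀ p q, B p q = B q p
  X_mul_X_mul : ∀ p q, B (X * p) (X * q) = B p q
  pos : ∀ p, p ≠ 0 → 0 < B p p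

/-- The monic orthogonal polynomials of a Toeplitz form, generated by the Szegő recursion. -/
noncomputable def szego (B : ℝ[X] →ₗ[ℝ] ℝ[X] →ₗ[ℝ] ℝ) : ℕ → ℝ[X]
  | 0 => 1
  | n + 1 => X * szego B n +
      C (-(B (X * szego B n) 1) / B (szego B n) (szego B n)) * reflect n (szego B n)

/-- The squared norm of the monic orthogonal polynomial. -/
noncomputable def szegoNorm (B : ℝ[X] →ₗ[ℝ] ℝ[X] →ₗ[ℝ] ℝ) (n : ℕ) : ℝ :=
  B (szego B n) (szego B n)

/-- The value at `0` of the monic orthogonal polynomial. -/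
noncomputable def verblunsky (B : ℝ[X] →ₗ[ℝ] ℝ[X] →ₗ[ℝ] ℝ) (n : ℕ) : ℝ :=
  (szego B n).coeff 0

/-! ### Szegő recursion for a real Toeplitz form -/

section Szego

variable {B : ℝ[X] →ₗ[ℝ] ℝ[X] →ₗ[ℝ] ℝ}

lemma natDegree_le_coeff_szego (B : ℝ[X] →ₗ[ℝ] ℝ[X] →ₗ[ℝ] ℝ) (n : ℕ) :
    (szego B n).natDegree ≤ n ∧ (szego B n).coeff n = 1 := by
  induction n with
  | zero => simp [szego]
  | succ n ih =>
    have h1 : (szego B n).coeff (n + 1) = 0 := coeff_eq_zero_of_natDegree_lt (by omega)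
    constructor
    · refine (natDegree_add_le _ _).trans (max_le ?_ ?_)
      · refine natDegree_mul_le.trans ?_
        rw [natDegree_X]; omega
      · refine (natDegree_C_mul_le _ _).trans ?_
        refine natDegree_le_iff_coeff_eq_zero.2 fun k hk => ?_
        -- `reflect n` leaves indices above `n` in place, where the coefficients vanish.
        rw [coeff_reflect, revAt_eq_self_of_lt (by omega)]
        exact coeff_eq_zero_of_natDegree_lt (by omega)
    · simp [szego, coeff_reflect, revAt_eq_self_of_lt, h1, ih.2]

lemma natDegree_szego_le (n : ℕ) : (szego B n).natDegree ≤ n :=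
  (natDegree_le_coeff_szego B n).1

lemma coeff_szego_self (n : ℕ) : (szego B n).coeff n = 1 :=
  (natDegree_le_coeff_szego B n).2

lemma szego_ne_zero (n : ℕ) : szego B n ≠ 0 := by
  intro h
  simpa [h] using coeff_szego_self (B := B) n

lemma monic_szego (n : ℕ) : (szego B n).Monic :=
  monic_of_natDegree_le_of_coeff_eq_one n (natDegree_szego_le n) (coeff_szego_self n)

lemma natDegree_szego (n : ℕ) : (szego B n).natDegree = n :=
  le_antisymm (natDegree_szego_le n) (le_natDegree_of_ne_zero (by simp [coeff_szego_self]))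

lemma verblunsky_zero : verblunsky B 0 = 1 := by simp [verblunsky, szego]

/-- Reversal moves the leading coefficient `1` to degree `0`, so the constant in the recursion is
exactly the new value at `0`. -/
lemma verblunsky_succ (n : ℕ) : verblunsky B (n + 1) =
    -(B (X * szego B n) 1) / B (szego B n) (szego B n) := by
  simp [verblunsky, szego, coeff_reflect, revAt_le, coeff_szego_self]

lemma szego_succ (n : ℕ) : szego B (n + 1) =
    X * szego B n + C (verblunsky B (n + 1)) * reflect n (szego B n) := by
  rw [verblunsky_succ, szego]

namespace IsToeplitzForm

lemma X_pow_mul (hB : IsToeplitzForm B) (k : ℕ) (p q : ℝ[X]) :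
    B (X ^ k * p) (X ^ k * q) = B p q := by
  induction k with
  | zero => simp
  | succ k ih => rw [pow_succ', mul_assoc, mul_assoc, hB.X_mul_X_mul, ih]

/-- Shift invariance makes a Gram entry depend only on the difference of the exponents. -/
lemma X_pow_X_pow (hB : IsToeplitzForm B) {a b c d : ℕ} (h : a + d = c + b) :
    B (X ^ a) (X ^ b) = B (X ^ c) (X ^ d) := by
  rw [← hB.X_pow_mul d, ← pow_add, ← pow_add, ← hB.X_pow_mul b (X ^ c), ← pow_add, ← pow_add]
  congr 2
  · congr 1; omega
  · omega

/-- On monomials, reversal changes the sign of the difference of exponents, which symmetry of the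
form undoes; bilinearity does the rest. -/
lemma reflect_reflect (hB : IsToeplitzForm B) {N : ℕ} {p q : ℝ[X]} (hp : p.natDegree ≤ N)
    (hq : q.natDegree ≤ N) : B (reflect N p) (reflect N q) = B p q := by
  refine induction_with_natDegree_le (fun p => B (reflect N p) (reflect N q) = B p q) N
    (by simp) (fun i a _ hi => ?_) (fun f g _ _ hf hg => ?_) p hp
  · refine induction_with_natDegree_le
      (fun q => B (reflect N (C a * X ^ i)) (reflect N q) = B (C a * X ^ i) q) N
      (by simp) (fun j b _ hj => ?_) (fun f g _ _ hf hg => ?_) q hq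
    · rw [reflect_C_mul_X_pow, reflect_C_mul_X_pow, revAt_le hi, revAt_le hj]
      simp only [← smul_eq_C_mul, map_smul, LinearMap.smul_apply]
      rw [hB.X_pow_X_pow (c := j) (d := i) (by omega), hB.symm]
    · rw [reflect_add, map_add, map_add, hf, hg]
  · rw [reflect_add, map_add, map_add, LinearMap.add_apply, hf, hg, LinearMap.add_apply]

end IsToeplitzForm

/-- This is `l_{n+1} = l_n + r̃_{n+1} r̃_n`, the source of the later elimination; the `if` encodes
`l_0 = 0`. -/
lemma coeff_szego_succ (n : ℕ) : (szego B (n + 1)).coeff n =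
    (if n = 0 then 0 else (szego B n).coeff (n - 1)) +
      verblunsky B (n + 1) * verblunsky B n := by
  rw [szego_succ, coeff_add, coeff_C_mul, coeff_reflect, revAt_le le_rfl, Nat.sub_self]
  rcases n with _ | n
  · simp [verblunsky]
  · simp [verblunsky]

lemma natDegree_reflect_le_of_le {n : ℕ} {f : ℝ[X]} (h : f.natDegree ≤ n) :
    (reflect n f).natDegree ≤ n := by
  refine natDegree_le_iff_coeff_eq_zero.2 fun k hk => ?_
  rw [coeff_reflect, revAt_eq_self_of_lt (by omega)]
  exact coeff_eq_zero_of_natDegree_lt (by omega)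

lemma apply_eq_coeff_mul_of_orthogonal {ℓ : ℝ[X] →ₗ[ℝ] ℝ} {n : ℕ} (h : ∀ k < n, ℓ (X ^ k) = 0)
    {p : ℝ[X]} (hp : p.natDegree ≤ n) : ℓ p = p.coeff n * ℓ (X ^ n) := by
  rw [p.as_sum_range' (n + 1) (by omega), map_sum, Finset.sum_range_succ, Finset.sum_eq_zero]
  · simp only [← C_mul_X_pow_eq_monomial, ← smul_eq_C_mul, map_smul, zero_add, smul_eq_mul]
    congr 1
    simp [coeff_X_pow]
  · intro k hk
    rw [← C_mul_X_pow_eq_monomial, ← smul_eq_C_mul, map_smul, h k (Finset.mem_range.1 hk),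
      smul_zero]

namespace IsToeplitzForm

lemma szegoNorm_pos (hB : IsToeplitzForm B) (n : ℕ) : 0 < szegoNorm B n :=
  hB.pos _ (szego_ne_zero n)

lemma reflect_szego_apply (hB : IsToeplitzForm B) {n : ℕ} {p : ℝ[X]} (hp : p.natDegree ≤ n) :
    B (reflect n (szego B n)) p = B (szego B n) (reflect n p) := by
  have hd : (reflect n p).natDegree ≤ n := natDegree_reflect_le_of_le hp
  rw [← hB.reflect_reflect (natDegree_szego_le n) hd]
  congr 1
  ext k
  simp

lemma X_mul_szego_one (hB : IsToeplitzForm B) (n : ℕ) :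
    B (X * szego B n) 1 = -verblunsky B (n + 1) * szegoNorm B n := by
  have := (hB.szegoNorm_pos n).ne'
  rw [verblunsky_succ]
  unfold szegoNorm at *
  field_simp

/-- For `k ≥ 1` both terms of the recursion are already orthogonal to `X ^ k`: the first by shift
invariance, the second because reversal turns `X ^ k` into a power below `n`. The recursion constant
is what cancels the case `k = 0`. -/
lemma szego_X_pow (hB : IsToeplitzForm B) (n : ℕ) :
    ∀ k < n, B (szego B n) (X ^ k) = 0 := by
  induction n with
  | zero => simp
  | succ n ih =>
    have key {p : ℝ[X]} (hp : p.natDegree ≤ n) :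
        B (szego B n) p = p.coeff n * B (szego B n) (X ^ n) :=
      apply_eq_coeff_mul_of_orthogonal ih hp
    have hn : szegoNorm B n = B (szego B n) (X ^ n) := by
      rw [szegoNorm, key (natDegree_szego_le n), coeff_szego_self, one_mul]
    intro k hk
    rw [szego_succ, map_add, LinearMap.add_apply, ← smul_eq_C_mul, map_smul, LinearMap.smul_apply,
      hB.reflect_szego_apply (by rw [natDegree_X_pow]; omega), key, ← hn, coeff_reflect,
      revAt_le le_rfl]
    · rcases k with _ | k
      · rw [pow_zero, hB.X_mul_szego_one]
        simp
      · rw [pow_succ' X k, hB.X_mul_X_mul, ih k (by omega)]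
        simp
    · rw [← one_mul (X ^ k), ← C_1, reflect_C_mul_X_pow, C_1, one_mul, revAt_le (by omega),
        natDegree_X_pow]
      omega

lemma szegoNorm_eq (hB : IsToeplitzForm B) (n : ℕ) :
    szegoNorm B n = B (szego B n) (X ^ n) := by
  rw [szegoNorm, apply_eq_coeff_mul_of_orthogonal (hB.szego_X_pow n) (natDegree_szego_le n),
    coeff_szego_self, one_mul]

lemma szego_apply (hB : IsToeplitzForm B) {n : ℕ} {p : ℝ[X]} (hp : p.natDegree ≤ n) :
    B (szego B n) p = p.coeff n * szegoNorm B n := by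
  rw [hB.szegoNorm_eq, apply_eq_coeff_mul_of_orthogonal (hB.szego_X_pow n) hp]

lemma szego_szego (hB : IsToeplitzForm B) {m n : ℕ} (h : m ≠ n) :
    B (szego B m) (szego B n) = 0 := by
  wlog hlt : n < m generalizing m n
  · rw [hB.symm]; exact this h.symm (by omega)
  have := natDegree_szego_le (B := B) n
  rw [hB.szego_apply (by omega), coeff_eq_zero_of_natDegree_lt (by omega), zero_mul]

lemma natDegree_sub_monomial_le {n : ℕ} {p : ℝ[X]} (hp : p.natDegree ≤ n + 1) :
    (p - C (p.coeff (n + 1)) * X ^ (n + 1)).natDegree ≤ n := by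
  refine natDegree_le_iff_coeff_eq_zero.2 fun k hk => ?_
  rcases eq_or_ne k (n + 1) with rfl | h
  · simp
  · simp [coeff_X_pow, h, coeff_eq_zero_of_natDegree_lt (show p.natDegree < k by omega)]

/-- Relative to degree `n + 1`, the reversed polynomial is the reversal of `X * szego B n`, and `X ^
(n + 1)` is the reversal of `1`. -/
lemma reflect_szego_X_pow_succ (hB : IsToeplitzForm B) (n : ℕ) :
    B (reflect n (szego B n)) (X ^ (n + 1)) = -verblunsky B (n + 1) * szegoNorm B n := by
  have hS := natDegree_szego_le (B := B) n
  have hX : reflect 1 (X : ℝ[X]) = 1 := by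
    simp
  have h1 : reflect (1 + n) (X * szego B n) = reflect n (szego B n) := by
    rw [reflect_mul _ _ natDegree_X_le hS, hX, one_mul]
  have h2 : reflect (1 + n) (1 : ℝ[X]) = X ^ (n + 1) := by
    simp [add_comm]
  rw [← h1, ← h2, hB.reflect_reflect, hB.X_mul_szego_one]
  · refine natDegree_mul_le.trans ?_
    rw [natDegree_X]; omega
  · simp

/-- The reversed orthogonal polynomial tested against degree at most `n + 1`. -/
lemma reflect_szego_apply_succ (hB : IsToeplitzForm B) {n : ℕ} {p : ℝ[X]}
    (hp : p.natDegree ≤ n + 1) : B (reflect n (szego B n)) p =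
      (p.coeff 0 - p.coeff (n + 1) * verblunsky B (n + 1)) * szegoNorm B n := by
  have hd := natDegree_sub_monomial_le hp
  set q := p - C (p.coeff (n + 1)) * X ^ (n + 1) with hq
  have hpq : p = q + p.coeff (n + 1) • X ^ (n + 1) := by rw [smul_eq_C_mul, hq]; ring
  have h0 : q.coeff 0 = p.coeff 0 := by simp [hq]
  have hr : (reflect n q).natDegree ≤ n := natDegree_reflect_le_of_le hd
  conv_lhs => rw [hpq]
  rw [map_add, map_smul, hB.reflect_szego_X_pow_succ, hB.reflect_szego_apply hd,
    hB.szego_apply hr, coeff_reflect, revAt_le le_rfl, Nat.sub_self, h0, smul_eq_mul]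
  ring

/-- The orthogonal polynomial tested against degree at most `n + 1`. -/
lemma szego_apply_succ (hB : IsToeplitzForm B) {n : ℕ} {p : ℝ[X]} (hp : p.natDegree ≤ n + 1) :
    B (szego B n) p =
      (p.coeff n - p.coeff (n + 1) * (szego B (n + 1)).coeff n) * szegoNorm B n := by
  -- Removing this multiple of the next orthogonal polynomial lowers the degree without changing the
  -- pairing.
  have h : (p - p.coeff (n + 1) • szego B (n + 1)).natDegree ≤ n := by
    refine natDegree_le_iff_coeff_eq_zero.2 fun k hk => ?_
    rcases eq_or_ne k (n + 1) with rfl | h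
    · simp [coeff_szego_self]
    · have := natDegree_szego_le (B := B) (n + 1)
      simp [coeff_eq_zero_of_natDegree_lt (show p.natDegree < k by omega),
        coeff_eq_zero_of_natDegree_lt (show (szego B (n + 1)).natDegree < k by omega)]
  have := hB.szego_apply h
  rw [map_sub, map_smul, hB.szego_szego (by omega)] at this
  simpa using this

lemma szegoNorm_succ (hB : IsToeplitzForm B) (n : ℕ) :
    szegoNorm B (n + 1) = (1 - verblunsky B (n + 1) ^ 2) * szegoNorm B n := by
  rw [hB.szegoNorm_eq (n + 1)]
  conv_lhs => rw [szego_succ, pow_succ' X n]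
  rw [map_add, LinearMap.add_apply, hB.X_mul_X_mul, ← pow_succ' X n, ← smul_eq_C_mul, map_smul,
    LinearMap.smul_apply, hB.reflect_szego_X_pow_succ, ← hB.szegoNorm_eq, smul_eq_mul]
  ring

lemma one_sub_verblunsky_sq_pos (hB : IsToeplitzForm B) (n : ℕ) :
    0 < 1 - verblunsky B (n + 1) ^ 2 := by
  have h := hB.szegoNorm_pos (n + 1)
  rw [hB.szegoNorm_succ] at h
  exact pos_of_mul_pos_left h (hB.szegoNorm_pos n).le

end IsToeplitzForm

/-! ### Pearson equation and the difference equation -/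

/-- The weak form of the differential equation `(1 - 2cζ + ζ²) ζ W' = (ζ² - 1) W` of the weight,
tested against `ζ⁻¹ f(ζ) g(1/ζ)`. -/
def IsPearson (c : ℝ) (B : ℝ[X] →ₗ[ℝ] ℝ[X] →ₗ[ℝ] ℝ) : Prop :=
  ∀ f g : ℝ[X],
    B (X * (X * derivative f)) g + B (X * derivative f) (X * g) - 2 * c * B (X * derivative f) g
      - (B (X * f) (X * derivative g) + B f (X * (X * derivative g))
        - 2 * c * B f (X * derivative g))
      + 2 * B (X * f) g - 2 * B f (X * g) = 0

lemma coeff_X_mul_derivative (f : ℝ[X]) (k : ℕ) :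
    (X * derivative f).coeff k = k * f.coeff k := by
  rcases k with _ | k
  · simp
  · rw [coeff_X_mul, coeff_derivative]; push_cast; ring

lemma natDegree_X_mul_derivative_le (f : ℝ[X]) : (X * derivative f).natDegree ≤ f.natDegree := by
  refine natDegree_le_iff_coeff_eq_zero.2 fun k hk => ?_
  rw [coeff_X_mul_derivative, coeff_eq_zero_of_natDegree_lt hk, mul_zero]

lemma natDegree_X_mul_le {n : ℕ} {f : ℝ[X]} (h : f.natDegree ≤ n) :
    (X * f).natDegree ≤ n + 1 := by
  refine natDegree_mul_le.trans ?_
  rw [natDegree_X]; omega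

/-- The weak differential equation is applied to `S_{n+1}` and its reversal. Every pairing then
stays within one degree of orthogonality, so only a few end coefficients remain and `h_{n+1}`
factors out. -/
lemma verblunsky_pearson (hB : IsToeplitzForm B) {c : ℝ} (hP : IsPearson c B) (n : ℕ) :
    (1 - verblunsky B (n + 1) ^ 2) *
      ((n + 3) * verblunsky B (n + 2) + (n + 1) * verblunsky B n) =
    2 * verblunsky B (n + 1) * (c * (n + 1) + (szego B (n + 1)).coeff n) := by
  have hS := natDegree_szego_le (B := B) (n + 1)
  have hR := natDegree_reflect_le_of_le hS
  have hDS := (natDegree_X_mul_derivative_le (szego B (n + 1))).trans hS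
  have hDR := (natDegree_X_mul_derivative_le (reflect (n + 1) (szego B (n + 1)))).trans hR
  have h := hP (szego B (n + 1)) (reflect (n + 1) (szego B (n + 1)))
  have hh := (hB.szegoNorm_pos (n + 1)).ne'
  -- The recursion gives the linear coefficient as `r̃_n + r̃_{n+1} l_n`; here `l_n` is rewritten as
  -- `l_{n+1} - r̃_{n+1} r̃_n`.
  have hs : (szego B (n + 1)).coeff 1 = verblunsky B n +
      verblunsky B (n + 1) * ((szego B (n + 1)).coeff n - verblunsky B (n + 1) * verblunsky B n) := by
    rw [coeff_szego_succ n]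
    conv_lhs => rw [szego_succ]
    rcases n with _ | n
    · simp [verblunsky, szego, coeff_one]
    · simp [verblunsky, coeff_reflect, revAt_le]
  have hR0 : (reflect (n + 1) (szego B (n + 1))).coeff (n + 1) = verblunsky B (n + 1) := by
    simp [coeff_reflect, revAt_le, verblunsky]
  have hR1 : (reflect (n + 1) (szego B (n + 1))).coeff n = (szego B (n + 1)).coeff 1 := by
    simp [coeff_reflect, revAt_le]
  have hl := coeff_szego_succ (B := B) (n + 1)
  rw [if_neg n.succ_ne_zero, Nat.add_sub_cancel] at hl
  set S := szego B (n + 1) with hSdef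
  set R := reflect (n + 1) S with hRdef
  have hS' : S.coeff (n + 1) = 1 := coeff_szego_self _
  have hRz : R.coeff (n + 1 + 1) = 0 := coeff_eq_zero_of_natDegree_lt (by omega)
  have hSz : S.coeff (n + 1 + 1) = 0 := coeff_eq_zero_of_natDegree_lt (by omega)
  have hSz' : S.coeff (n + 1 + 1 + 1) = 0 := coeff_eq_zero_of_natDegree_lt (by omega)
  have t1 : B (X * (X * derivative S)) R = -((n + 1) * verblunsky B (n + 2)) * szegoNorm B (n + 1) := by
    rw [hB.symm, hB.reflect_szego_apply_succ (natDegree_X_mul_le hDS), coeff_X_mul,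
      coeff_X_mul_derivative, hS']
    simp
  have t2 : B (X * derivative S) (X * R) = S.coeff 1 * szegoNorm B (n + 1) := by
    rw [hB.X_mul_X_mul, hB.symm, hB.reflect_szego_apply_succ
      ((natDegree_derivative_le _).trans (by omega)), coeff_derivative, coeff_derivative, hSz']
    simp
  have t3 : B (X * derivative S) R = 0 := by
    rw [hB.symm, hB.reflect_szego_apply_succ (by omega), coeff_X_mul_derivative,
      coeff_X_mul_derivative, hSz]
    simp
  have t4 : B (X * S) (X * derivative R) = 0 := by
    rw [hB.X_mul_X_mul, hB.szego_apply ((natDegree_derivative_le _).trans (by omega)),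
      coeff_derivative, hRz]
    simp
  have t5 : B S (X * (X * derivative R)) = (n * S.coeff 1 - (n + 1) * verblunsky B (n + 1) *
      (S.coeff n + verblunsky B (n + 2) * verblunsky B (n + 1))) * szegoNorm B (n + 1) := by
    rw [hB.szego_apply_succ (natDegree_X_mul_le hDR), coeff_X_mul, coeff_X_mul,
      coeff_X_mul_derivative, coeff_X_mul_derivative, hR0, hR1, hl]
    push_cast; ring
  have t6 : B S (X * derivative R) = (n + 1) * verblunsky B (n + 1) * szegoNorm B (n + 1) := by
    rw [hB.szego_apply hDR, coeff_X_mul_derivative, hR0]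
    push_cast; ring
  have t7 : B (X * S) R = -verblunsky B (n + 2) * szegoNorm B (n + 1) := by
    rw [hB.symm, hB.reflect_szego_apply_succ (natDegree_X_mul_le hS), coeff_X_mul, hS']
    simp
  have t8 : B S (X * R) = (S.coeff 1 - verblunsky B (n + 1) *
      (S.coeff n + verblunsky B (n + 2) * verblunsky B (n + 1))) * szegoNorm B (n + 1) := by
    rw [hB.szego_apply_succ (natDegree_X_mul_le hR), coeff_X_mul, coeff_X_mul, hR0, hR1, hl]
  rw [t1, t2, t3, t4, t5, t6, t7, t8, hs] at h
  apply mul_right_cancel₀ hh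
  linear_combination -h

/-- The cleared third order difference equation for the values at `0`. -/
lemma verblunsky_diffEqCleared (hB : IsToeplitzForm B) {c : ℝ} (hP : IsPearson c B) (n : ℕ) :
    DiffEqCleared c (verblunsky B) n := by
  have h1 := verblunsky_pearson hB hP n
  unfold DiffEqCleared
  -- At index `0` one relation suffices, since `l_1 = r̃_1` and `1 - r̃_0² = 0`.
  rcases n with _ | n
  · have := coeff_szego_succ (B := B) 0
    rw [this] at h1
    simp only [verblunsky_zero, Nat.cast_zero, if_true] at h1 ⊢
    linear_combination -h1
  · have h0 := verblunsky_pearson hB hP n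
    have := coeff_szego_succ (B := B) (n + 1)
    rw [if_neg n.succ_ne_zero, Nat.add_sub_cancel] at this
    rw [this] at h1
    push_cast at h1 h0 ⊢
    -- These multipliers cancel `l_{n+1}` between the two relations; what is left of it is the
    -- increment `r̃_{n+2} r̃_{n+1}`.
    linear_combination verblunsky B (n + 2) * h0 - verblunsky B (n + 1) * h1

end Szego

/-! ### The Toeplitz form of the weight `2|cos θ - c|` -/

open MeasureTheory

/-- The value `p(e^{iθ}) conj q(e^{iθ})`. -/
noncomputable def circlePair (p q : ℝ[X]) (θ : ℝ) : ℂ :=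
  aeval (Complex.exp (θ * Complex.I)) p *
    (starRingEnd ℂ) (aeval (Complex.exp (θ * Complex.I)) q)

@[fun_prop]
lemma continuous_aeval_exp (p : ℝ[X]) :
    Continuous fun θ : ℝ => aeval (Complex.exp (θ * Complex.I)) p :=
  (Polynomial.continuous_aeval p).comp (by fun_prop)

@[fun_prop]
lemma continuous_circlePair (p q : ℝ[X]) : Continuous (circlePair p q) := by
  unfold circlePair
  exact (continuous_aeval_exp p).mul (Complex.continuous_conj.comp (continuous_aeval_exp q))

/-- The integral `∫_0^{2π} 2 |cos θ - c| F(θ) dθ`. -/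
noncomputable def cosIntegral (c : ℝ) (F : ℝ → ℂ) : ℂ :=
  ∫ θ in (0 : ℝ)..(2 * Real.pi), ((2 * |Real.cos θ - c| : ℝ) : ℂ) * F θ

lemma intervalIntegrable_cosIntegral (c : ℝ) {F : ℝ → ℂ} (hF : Continuous F) (a b : ℝ) :
    IntervalIntegrable (fun θ => ((2 * |Real.cos θ - c| : ℝ) : ℂ) * F θ) volume a b := by
  apply Continuous.intervalIntegrable
  fun_prop

lemma cosIntegral_add (c : ℝ) {F G : ℝ → ℂ} (hF : Continuous F) (hG : Continuous G) :
    cosIntegral c (F + G) = cosIntegral c F + cosIntegral c G := by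
  unfold cosIntegral
  rw [← intervalIntegral.integral_add (intervalIntegrable_cosIntegral c hF _ _)
    (intervalIntegrable_cosIntegral c hG _ _)]
  simp [mul_add]

lemma cosIntegral_smul (c r : ℝ) (F : ℝ → ℂ) :
    cosIntegral c (r • F) = r * cosIntegral c F := by
  unfold cosIntegral
  rw [← intervalIntegral.integral_const_mul]
  congr 1; ext θ
  simp only [Pi.smul_apply, Complex.real_smul]
  ring

lemma circlePair_add_left (p p' q : ℝ[X]) :
    circlePair (p + p') q = circlePair p q + circlePair p' q := by
  ext θ; simp [circlePair, add_mul]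

lemma circlePair_add_right (p q q' : ℝ[X]) :
    circlePair p (q + q') = circlePair p q + circlePair p q' := by
  ext θ; simp [circlePair, mul_add]

lemma circlePair_smul_left (r : ℝ) (p q : ℝ[X]) :
    circlePair (r • p) q = r • circlePair p q := by
  ext θ; simp [circlePair, mul_assoc]

lemma circlePair_smul_right (r : ℝ) (p q : ℝ[X]) :
    circlePair p (r • q) = r • circlePair p q := by
  ext θ; simp [circlePair, mul_left_comm]

/-- The Toeplitz form of the weight `2 |cos θ - c|`. -/
noncomputable def cosForm (c : ℝ) : ℝ[X] →ₗ[ℝ] ℝ[X] →ₗ[ℝ] ℝ :=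
  LinearMap.mk₂ ℝ (fun p q => (cosIntegral c (circlePair p q)).re)
    (fun p p' q => by
      rw [circlePair_add_left, cosIntegral_add c (continuous_circlePair _ _)
        (continuous_circlePair _ _), Complex.add_re])
    (fun r p q => by
      rw [circlePair_smul_left, cosIntegral_smul, Complex.re_ofReal_mul, smul_eq_mul])
    (fun p q q' => by
      rw [circlePair_add_right, cosIntegral_add c (continuous_circlePair _ _)
        (continuous_circlePair _ _), Complex.add_re])
    (fun r p q => by
      rw [circlePair_smul_right, cosIntegral_smul, Complex.re_ofReal_mul, smul_eq_mul])

lemma cosForm_apply (c : ℝ) (p q : ℝ[X]) :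
    cosForm c p q = (cosIntegral c (circlePair p q)).re := rfl

lemma aeval_conj_real (p : ℝ[X]) (z : ℂ) :
    aeval ((starRingEnd ℂ) z) p = (starRingEnd ℂ) (aeval z p) := by
  simpa using (aeval_algHom_apply (Complex.conjAe : ℂ →ₐ[ℝ] ℂ) z p)

lemma exp_two_pi_sub (θ : ℝ) : Complex.exp (((2 * Real.pi - θ : ℝ) : ℂ) * Complex.I) =
    (starRingEnd ℂ) (Complex.exp (θ * Complex.I)) := by
  rw [← Complex.exp_conj, map_mul, Complex.conj_I, Complex.conj_ofReal]
  push_cast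
  rw [sub_mul, Complex.exp_sub, Complex.exp_two_pi_mul_I, one_div, ← Complex.exp_neg]
  congr 1; ring

/-- The substitution `θ ↦ 2π - θ` conjugates the integrand, so the integral is real and taking its
real part loses nothing. -/
lemma cosForm_coe (c : ℝ) (p q : ℝ[X]) :
    (cosForm c p q : ℂ) = cosIntegral c (circlePair p q) := by
  rw [cosForm_apply, ← Complex.conj_eq_iff_re]
  unfold cosIntegral
  rw [← intervalIntegral.intervalIntegral_conj]
  have h := intervalIntegral.integral_comp_sub_left (a := 0) (b := 2 * Real.pi)
    (fun θ => ((2 * |Real.cos θ - c| : ℝ) : ℂ) * circlePair p q θ) (2 * Real.pi)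
  rw [sub_self, sub_zero] at h
  rw [← h]
  congr 1; ext θ
  unfold circlePair
  rw [exp_two_pi_sub, aeval_conj_real, aeval_conj_real, Real.cos_two_pi_sub]
  simp only [map_mul, Complex.conj_ofReal, Complex.conj_conj]

lemma normSq_exp_mul_I (θ : ℝ) :
    Complex.exp (θ * Complex.I) * (starRingEnd ℂ) (Complex.exp (θ * Complex.I)) = 1 := by
  rw [Complex.mul_conj, Complex.normSq_eq_norm_sq, Complex.norm_exp_ofReal_mul_I]; simp

lemma two_cos_eq (θ : ℝ) : 2 * (Real.cos θ : ℂ) =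
    Complex.exp (θ * Complex.I) + (starRingEnd ℂ) (Complex.exp (θ * Complex.I)) := by
  rw [Complex.add_conj, Complex.exp_ofReal_mul_I_re]; push_cast; ring

/-- Multiplying the weight by `cos θ - c` smooths its kinks, so that integration by parts needs no
splitting of the interval. -/
lemma hasDerivAt_mul_abs (y : ℝ) : HasDerivAt (fun y : ℝ => y * |y|) (2 * |y|) y := by
  rcases lt_trichotomy y 0 with h | rfl | h
  · have := ((hasDerivAt_id y).mul (hasDerivAt_abs_neg h))
    refine this.congr_deriv ?_
    rw [id, abs_of_neg h]; ring
  · rw [hasDerivAt_iff_isLittleO]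
    simp only [abs_zero, mul_zero, sub_zero, smul_eq_mul]
    have := (Asymptotics.isBigO_refl (fun y : ℝ => y) (nhds 0)).mul_isLittleO
      (f₂ := fun y : ℝ => |y|) (g₂ := fun _ : ℝ => (1 : ℝ))
      ((Asymptotics.isLittleO_one_iff ℝ).2 (by simpa using (continuous_abs.tendsto (0 : ℝ))))
    simpa using this
  · have := ((hasDerivAt_id y).mul (hasDerivAt_abs_pos h))
    refine this.congr_deriv ?_
    rw [id, abs_of_pos h]; ring

lemma exp_infinite : (Set.range fun θ : ℝ => Complex.exp (θ * Complex.I)).Infinite := by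
  have h : InjOn (fun θ : ℝ => Complex.exp (θ * Complex.I)) (Icc 0 1) := by
    intro a ha b hb hab
    have := congrArg Complex.im hab
    simp only [Complex.exp_ofReal_mul_I_im] at this
    have hpi := Real.pi_gt_three
    exact Real.strictMonoOn_sin.injOn ⟨by linarith [ha.1], by linarith [ha.2]⟩
      ⟨by linarith [hb.1], by linarith [hb.2]⟩ this
  exact ((Icc_infinite zero_lt_one).image h).mono (image_subset_range _ _)

/-- The factor `X² - 2cX + 1` vanishes at the points of the circle where `cos θ = c`. Its product
with `p` therefore vanishes on the whole circle, which is infinite. -/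
lemma eq_zero_of_cos_mul_norm {c : ℝ} {p : ℝ[X]}
    (h : ∀ θ ∈ Icc (0 : ℝ) (2 * Real.pi),
      2 * |Real.cos θ - c| * ‖aeval (Complex.exp (θ * Complex.I)) p‖ ^ 2 = 0) : p = 0 := by
  have hq : ∀ θ : ℝ, aeval (Complex.exp (θ * Complex.I)) (p * (X ^ 2 - C (2 * c) * X + 1)) = 0 := by
    intro θ
    have hper : ∃ θ' ∈ Ico (0 : ℝ) (0 + 2 * Real.pi),
        Complex.exp (θ * Complex.I) = Complex.exp (θ' * Complex.I) := by
      refine ⟨toIcoMod Real.two_pi_pos 0 θ, toIcoMod_mem_Ico _ _ _, ?_⟩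
      have := toIcoMod_add_toIcoDiv_zsmul Real.two_pi_pos 0 θ
      conv_lhs => rw [← this]
      rw [Complex.exp_eq_exp_iff_exists_int]
      refine ⟨toIcoDiv Real.two_pi_pos 0 θ, ?_⟩
      push_cast [zsmul_eq_mul]; ring
    obtain ⟨θ', hθ', e⟩ := hper
    rw [e]
    rw [zero_add] at hθ'
    have h1 := h θ' ⟨hθ'.1, hθ'.2.le⟩
    have h2 : Real.cos θ' - c = 0 ∨ aeval (Complex.exp (θ' * Complex.I)) p = 0 := by
      simpa using h1
    rw [map_mul]
    rcases h2 with h2 | h2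
    · have e1 : (2 * (Real.cos θ' : ℂ)) = 2 * c := by rw [sub_eq_zero.1 h2]
      rw [two_cos_eq] at e1
      have e2 := normSq_exp_mul_I θ'
      apply mul_eq_zero_of_right
      simp only [map_add, map_sub, map_mul, map_pow, aeval_X, aeval_C, map_one]
      rw [Complex.coe_algebraMap]
      push_cast
      linear_combination Complex.exp (θ' * Complex.I) * e1 - e2
    · rw [h2, zero_mul]
  have hz : (p * (X ^ 2 - C (2 * c) * X + 1)).map (algebraMap ℝ ℂ) = 0 := by
    refine eq_zero_of_infinite_isRoot _ (exp_infinite.mono ?_)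
    rintro _ ⟨θ, rfl⟩
    simpa [IsRoot, eval_map_algebraMap] using hq θ
  rw [Polynomial.map_eq_zero] at hz
  rcases mul_eq_zero.1 hz with h | h
  · exact h
  · have := congrArg (fun q => q.coeff 0) h
    simp at this

theorem isToeplitzForm_cosForm (c : ℝ) : IsToeplitzForm (cosForm c) where
  symm p q := by
    have h := cosForm_coe c q p
    rw [cosForm_apply, ← Complex.ofReal_inj, h]
    have : circlePair p q = fun θ => (starRingEnd ℂ) (circlePair q p θ) := by
      ext θ; simp [circlePair, mul_comm]
    have e : cosIntegral c (circlePair p q) =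
        (starRingEnd ℂ) (cosIntegral c (circlePair q p)) := by
      unfold cosIntegral
      rw [← intervalIntegral.intervalIntegral_conj, this]
      simp only [map_mul, Complex.conj_ofReal]
    rw [e, ← h]
    simp
  X_mul_X_mul p q := by
    rw [cosForm_apply, cosForm_apply]
    congr 2; ext θ
    simp only [circlePair, map_mul, aeval_X]
    linear_combination aeval (Complex.exp (θ * Complex.I)) p *
      (starRingEnd ℂ) (aeval (Complex.exp (θ * Complex.I)) q) * normSq_exp_mul_I θ
  pos p hp := by
    have e : cosForm c p p = ∫ θ in (0 : ℝ)..(2 * Real.pi),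
        2 * |Real.cos θ - c| * ‖aeval (Complex.exp (θ * Complex.I)) p‖ ^ 2 := by
      rw [← Complex.ofReal_inj, cosForm_coe, ← intervalIntegral.integral_ofReal]
      unfold cosIntegral circlePair
      congr 1; ext θ
      rw [Complex.mul_conj, Complex.normSq_eq_norm_sq]
      push_cast; ring
    rw [e]
    have hcont : Continuous fun θ : ℝ =>
        2 * |Real.cos θ - c| * ‖aeval (Complex.exp (θ * Complex.I)) p‖ ^ 2 := by
      have := continuous_aeval_exp p
      fun_prop
    by_contra hneg
    apply hp
    apply eq_zero_of_cos_mul_norm (c := c)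
    by_contra! hne
    obtain ⟨θ, hθ, h0⟩ := hne
    apply hneg
    refine intervalIntegral.integral_pos Real.two_pi_pos hcont.continuousOn (fun _ _ => by positivity)
      ⟨θ, hθ, lt_of_le_of_ne (by positivity) (Ne.symm h0)⟩

lemma hasDerivAt_aeval_exp (p : ℝ[X]) (θ : ℝ) :
    HasDerivAt (fun θ : ℝ => aeval (Complex.exp (θ * Complex.I)) p)
      (Complex.I * aeval (Complex.exp (θ * Complex.I)) (X * derivative p)) θ := by
  have h1 : HasDerivAt (fun θ : ℝ => Complex.exp (θ * Complex.I))
      (Complex.exp (θ * Complex.I) * (1 * Complex.I)) θ :=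
    ((Complex.ofRealCLM.hasDerivAt.mul_const Complex.I).cexp)
  have h2 := (p.hasDerivAt_aeval (Complex.exp (θ * Complex.I))).comp θ h1
  refine h2.congr_deriv ?_
  simp only [map_mul, aeval_X]
  ring

lemma hasDerivAt_circlePair (p q : ℝ[X]) (θ : ℝ) :
    HasDerivAt (circlePair p q)
      (Complex.I * (circlePair (X * derivative p) q θ - circlePair p (X * derivative q) θ)) θ := by
  have h1 := hasDerivAt_aeval_exp p θ
  have h2 := (hasDerivAt_aeval_exp q θ).star
  refine (h1.mul h2).congr_deriv ?_
  simp only [circlePair, Complex.star_def, map_mul, Complex.conj_I]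
  ring

lemma two_sin_eq (θ : ℝ) : 2 * Complex.I * (Real.sin θ : ℂ) =
    Complex.exp (θ * Complex.I) - (starRingEnd ℂ) (Complex.exp (θ * Complex.I)) := by
  rw [Complex.sub_conj, Complex.exp_ofReal_mul_I_im]; push_cast; ring

theorem isPearson_cosForm (c : ℝ) : IsPearson c (cosForm c) := by
  intro f g
  -- With `W = 2|cos θ - c|`, the prefactor is `ζ⁻¹(1 - 2cζ + ζ²) W`. The integral over a period of
  -- this derivative is zero, and expanding it gives the weak equation.
  have hd : ∀ θ : ℝ, HasDerivAt
      (fun θ : ℝ => ((4 * ((Real.cos θ - c) * |Real.cos θ - c|) : ℝ) : ℂ) * circlePair f g θ)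
      (Complex.I * (((2 * |Real.cos θ - c| : ℝ) : ℂ) *
        (circlePair (X * (X * derivative f) + (2 : ℝ) • (X * f) - (2 * c) • (X * derivative f)) g
          + circlePair (X * derivative f - (2 : ℝ) • f) (X * g)
          + (circlePair (-(X * f)) (X * derivative g)
          + circlePair (-f) (X * (X * derivative g) - (2 * c) • (X * derivative g)))) θ)) θ := by
    intro θ
    have h1 := (((hasDerivAt_mul_abs (Real.cos θ - c)).comp θ
      ((Real.hasDerivAt_cos θ).sub_const c)).const_mul 4).ofReal_comp
    refine (h1.mul (hasDerivAt_circlePair f g θ)).congr_deriv ?_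
    have e2 := two_cos_eq θ
    have e3 := two_sin_eq θ
    simp only [circlePair, Pi.add_apply, map_add, map_sub, map_mul, map_neg, map_smul, aeval_X,
      Complex.real_smul, Function.comp_apply, Complex.conj_ofReal]
    push_cast
    set z := Complex.exp (θ * Complex.I)
    set z' := (starRingEnd ℂ) z
    set F := aeval z f
    set G := (starRingEnd ℂ) (aeval z g)
    set F' := aeval z (derivative f)
    set G' := (starRingEnd ℂ) (aeval z (derivative g))
    set w : ℂ := ((|Real.cos θ - c| : ℝ) : ℂ)
    push_cast at e2 e3
    linear_combination 2 * Complex.I * w * (z * F' * G - F * z' * G') * e2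
      + w * F * G * (4 * Complex.I * e3 - 8 * Complex.sin θ * Complex.I_mul_I)
  have hint := intervalIntegral.integral_eq_sub_of_hasDerivAt (a := 0) (b := 2 * Real.pi) (fun θ _ => hd θ)
    (Continuous.intervalIntegrable (by fun_prop) _ _)
  have hper : circlePair f g (2 * Real.pi) = circlePair f g 0 := by
    simp [circlePair, Complex.exp_two_pi_mul_I]
  rw [hper, Real.cos_two_pi, Real.cos_zero, sub_self, intervalIntegral.integral_const_mul] at hint
  have h0 := (mul_eq_zero.1 hint).resolve_left Complex.I_ne_zero
  change cosIntegral c _ = 0 at h0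
  rw [cosIntegral_add c (by fun_prop) (by fun_prop), cosIntegral_add c (by fun_prop) (by fun_prop),
    cosIntegral_add c (by fun_prop) (by fun_prop), ← cosForm_coe, ← cosForm_coe, ← cosForm_coe,
    ← cosForm_coe] at h0
  simp only [← Complex.ofReal_add, Complex.ofReal_eq_zero] at h0
  simp only [map_add, map_sub, map_neg, map_smul, LinearMap.add_apply, LinearMap.sub_apply,
    LinearMap.neg_apply, LinearMap.smul_apply, smul_eq_mul] at h0
  linear_combination h0

/-- On `[0, 2π]` the difference `cos θ - cos α` is nonpositive between `α` and `2π - α` and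
nonnegative outside, so the antiderivative is taken with signs `+, -, +`. -/
lemma integral_abs_cos_sub {α : ℝ} (h0 : 0 ≤ α) (hpi : α ≤ Real.pi) {f F : ℝ → ℝ}
    (hf : Continuous f) (hF : ∀ θ, HasDerivAt F ((Real.cos θ - Real.cos α) * f θ) θ) :
    ∫ θ in (0 : ℝ)..(2 * Real.pi), |Real.cos θ - Real.cos α| * f θ =
      2 * F α - 2 * F (2 * Real.pi - α) + F (2 * Real.pi) - F 0 := by
  have hint : ∀ a b, IntervalIntegrable (fun θ => |Real.cos θ - Real.cos α| * f θ) volume a b :=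
    fun a b => Continuous.intervalIntegrable (by fun_prop) _ _
  have hFT : ∀ a b : ℝ, ∫ θ in a..b, (Real.cos θ - Real.cos α) * f θ = F b - F a := fun a b =>
    intervalIntegral.integral_eq_sub_of_hasDerivAt (fun θ _ => hF θ)
      (Continuous.intervalIntegrable (by fun_prop) _ _)
  rw [← intervalIntegral.integral_add_adjacent_intervals (hint 0 (2 * Real.pi - α)) (hint _ _),
    ← intervalIntegral.integral_add_adjacent_intervals (hint 0 α) (hint _ _)]
  have i1 : ∫ θ in (0 : ℝ)..α, |Real.cos θ - Real.cos α| * f θ = F α - F 0 := by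
    rw [← hFT]
    refine intervalIntegral.integral_congr fun θ hθ => ?_
    rw [uIcc_of_le h0] at hθ
    have := Real.cos_le_cos_of_nonneg_of_le_pi hθ.1 hpi hθ.2
    simp only [abs_of_nonneg (sub_nonneg.2 this)]
  have i2 : ∫ θ in α..(2 * Real.pi - α), |Real.cos θ - Real.cos α| * f θ =
      -(F (2 * Real.pi - α) - F α) := by
    rw [← hFT, ← intervalIntegral.integral_neg]
    refine intervalIntegral.integral_congr fun θ hθ => ?_
    rw [uIcc_of_le (by linarith)] at hθ
    have : Real.cos θ ≤ Real.cos α := by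
      rcases le_total θ Real.pi with h | h
      · exact Real.cos_le_cos_of_nonneg_of_le_pi h0 h hθ.1
      · rw [← Real.cos_two_pi_sub θ]
        exact Real.cos_le_cos_of_nonneg_of_le_pi h0 (by linarith) (by linarith [hθ.2])
    simp only [abs_of_nonpos (sub_nonpos.2 this), neg_mul]
  have i3 : ∫ θ in (2 * Real.pi - α)..(2 * Real.pi), |Real.cos θ - Real.cos α| * f θ =
      F (2 * Real.pi) - F (2 * Real.pi - α) := by
    rw [← hFT]
    refine intervalIntegral.integral_congr fun θ hθ => ?_
    rw [uIcc_of_le (by linarith)] at hθ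
    have : Real.cos α ≤ Real.cos θ := by
      rw [← Real.cos_two_pi_sub θ]
      exact Real.cos_le_cos_of_nonneg_of_le_pi (by linarith [hθ.2]) hpi (by linarith [hθ.1])
    simp only [abs_of_nonneg (sub_nonneg.2 this)]
  rw [i1, i2, i3]
  ring

lemma cosForm_one_one {α : ℝ} (h0 : 0 ≤ α) (hpi : α ≤ Real.pi) :
    cosForm (Real.cos α) 1 1 =
      8 * ((Real.pi / 2 - α) * Real.cos α + Real.sin α) := by
  have h := integral_abs_cos_sub h0 hpi (f := fun _ => 2)
    (F := fun θ => 2 * (Real.sin θ - Real.cos α * θ)) (by fun_prop) (fun θ => by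
      refine (((Real.hasDerivAt_sin θ).sub ((hasDerivAt_id θ).const_mul (Real.cos α))).const_mul
        2).congr_deriv ?_
      ring)
  rw [← Complex.ofReal_inj, cosForm_coe]
  unfold cosIntegral circlePair
  simp only [map_one, mul_one, intervalIntegral.integral_ofReal, Complex.ofReal_inj]
  simp only [mul_comm (2 : ℝ) |_|]
  rw [h, Real.sin_two_pi_sub]
  simp
  ring

lemma cosForm_X_one {α : ℝ} (h0 : 0 ≤ α) (hpi : α ≤ Real.pi) :
    cosForm (Real.cos α) X 1 =
      -(2 * (Real.pi - 2 * α + Real.sin (2 * α))) := by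
  have h := integral_abs_cos_sub h0 hpi (f := fun θ => 2 * Real.cos θ)
    (F := fun θ => θ + Real.sin θ * Real.cos θ - 2 * Real.cos α * Real.sin θ)
    (by fun_prop) (fun θ => by
      refine (((hasDerivAt_id θ).add ((Real.hasDerivAt_sin θ).mul (Real.hasDerivAt_cos θ))).sub
        ((Real.hasDerivAt_sin θ).const_mul _)).congr_deriv ?_
      linear_combination -Real.sin_sq_add_cos_sq θ)
  rw [cosForm_apply]
  have e : cosIntegral (Real.cos α) (circlePair X 1) =
      ∫ θ in (0 : ℝ)..(2 * Real.pi), ((2 * |Real.cos θ - Real.cos α| : ℝ) : ℂ) *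
        Complex.exp (θ * Complex.I) := by
    unfold cosIntegral circlePair
    simp
  rw [e, ← RCLike.re_eq_complex_re, ← intervalIntegral.intervalIntegral_re]
  · trans ∫ θ in (0 : ℝ)..(2 * Real.pi), |Real.cos θ - Real.cos α| * (2 * Real.cos θ)
    · congr 1; ext θ
      rw [RCLike.re_eq_complex_re, Complex.re_ofReal_mul, Complex.exp_ofReal_mul_I_re]
      ring
    · rw [h, Real.sin_two_pi_sub, Real.cos_two_pi_sub, Real.sin_two_mul α]
      simp
      ring
  · apply Continuous.intervalIntegrable
    fun_prop

lemma circleInt_eq_shift {E : Type*} [NormedAddCommGroup E] [NormedSpace ℝ E] (f : ℂ → E)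
    (a : ℝ) : circleInt f =
      ∫ θ in (0 : ℝ)..(2 * Real.pi), f (Complex.exp ((θ + a : ℝ) * Complex.I)) := by
  unfold circleInt
  have hper : Function.Periodic (fun θ : ℝ => f (Complex.exp (θ * Complex.I))) (2 * Real.pi) := by
    intro θ
    have : Complex.exp (((θ + 2 * Real.pi : ℝ) : ℂ) * Complex.I) = Complex.exp (θ * Complex.I) := by
      push_cast
      rw [add_mul, Complex.exp_add, Complex.exp_two_pi_mul_I, mul_one]
    simp only [this]
  have h := hper.intervalIntegral_add_eq 0 a
  rw [zero_add] at h
  rw [h, intervalIntegral.integral_comp_add_right (fun θ => f (Complex.exp (θ * Complex.I))) a,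
    zero_add, add_comm]

/-! ### Uniqueness of orthonormal polynomials -/

section Uniqueness

variable {w : ℂ → ℝ}

/-- The Hermitian form of a weight on the unit circle. -/
noncomputable def circleForm (w : ℂ → ℝ) (p q : ℂ[X]) : ℂ :=
  circleInt (fun z : ℂ => (w z : ℂ) * p.eval z * (starRingEnd ℂ) (q.eval z))

lemma continuous_circleForm_integrand (hw : Continuous w) (p q : ℂ[X]) :
    Continuous fun z : ℂ => (w z : ℂ) * p.eval z * (starRingEnd ℂ) (q.eval z) := by
  have := p.continuous
  have := Complex.continuous_conj.comp q.continuous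
  exact (by fun_prop : Continuous fun z : ℂ => (w z : ℂ) * p.eval z).mul this

lemma circleForm_add_left (hw : Continuous w) (p p' q : ℂ[X]) :
    circleForm w (p + p') q = circleForm w p q + circleForm w p' q := by
  unfold circleForm circleInt
  rw [← intervalIntegral.integral_add]
  · simp [mul_add, add_mul]
  · exact ((continuous_circleForm_integrand hw p q).comp (by fun_prop)).intervalIntegrable _ _
  · exact ((continuous_circleForm_integrand hw p' q).comp (by fun_prop)).intervalIntegrable _ _

lemma circleForm_C_mul_left (a : ℂ) (p q : ℂ[X]) :
    circleForm w (C a * p) q = a * circleForm w p q := by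
  unfold circleForm circleInt
  rw [← intervalIntegral.integral_const_mul]
  congr 1; ext θ
  simp only [eval_mul, eval_C]; ring

lemma circleForm_C_mul_right (a : ℂ) (p q : ℂ[X]) :
    circleForm w p (C a * q) = (starRingEnd ℂ) a * circleForm w p q := by
  unfold circleForm circleInt
  rw [← intervalIntegral.integral_const_mul]
  congr 1; ext θ
  simp only [eval_mul, eval_C, map_mul]; ring

namespace IsOrthonormalSystem

variable {φ φ' : ℕ → ℂ[X]}

lemma circleForm_eq (h : IsOrthonormalSystem w φ) (n m : ℕ) :
    circleForm w (φ n) (φ m) = if m = n then 1 else 0 :=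
  h.orthonormal n m

lemma leadingCoeff_ne_zero (h : IsOrthonormalSystem w φ) (n : ℕ) : (φ n).leadingCoeff ≠ 0 := by
  obtain ⟨κ, hκ, e⟩ := h.leadingCoeff_pos n
  rw [e]
  exact_mod_cast hκ.ne'

lemma exists_eq_add (h : IsOrthonormalSystem w φ) {n : ℕ} {p : ℂ[X]}
    (hp : p.degree < (n + 1 : ℕ)) : ∃ (a : ℂ) (q : ℂ[X]), q.degree < n ∧ p = C a * φ n + q := by
  have hl := h.leadingCoeff_ne_zero n
  refine ⟨p.coeff n / (φ n).leadingCoeff,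
    p - C (p.coeff n / (φ n).leadingCoeff) * φ n, ?_, by ring⟩
  rw [degree_lt_iff_coeff_zero] at hp ⊢
  intro k hk
  rw [coeff_sub, coeff_C_mul]
  rcases hk.eq_or_lt with rfl | hk
  · have : (φ n).coeff n = (φ n).leadingCoeff := by rw [leadingCoeff, h.natDegree_eq n]
    rw [this]
    field_simp
    ring
  · rw [hp k hk, coeff_eq_zero_of_natDegree_lt ((h.natDegree_eq n).trans_lt hk)]
    simp

lemma circleForm_of_degree_lt (h : IsOrthonormalSystem w φ) (hw : Continuous w) {n : ℕ} (d : ℕ)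
    (hd : d ≤ n) (p : ℂ[X]) (hp : p.degree < d) : circleForm w p (φ n) = 0 := by
  induction d generalizing p with
  | zero =>
    have : p = 0 := by simpa using hp
    simp [this, circleForm, circleInt]
  | succ d ih =>
    obtain ⟨a, q, hq, rfl⟩ := h.exists_eq_add hp
    rw [circleForm_add_left hw, circleForm_C_mul_left, h.circleForm_eq, if_neg (by omega),
      ih (by omega) q hq]
    simp

lemma eq_zero_of_circleForm (h : IsOrthonormalSystem w φ) (hw : Continuous w) (n : ℕ) (p : ℂ[X])
    (hp : p.degree < n) (h0 : ∀ m < n, circleForm w p (φ m) = 0) : p = 0 := by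
  induction n generalizing p with
  | zero => simpa using hp
  | succ n ih =>
    obtain ⟨a, q, hq, rfl⟩ := h.exists_eq_add hp
    have ha := h0 n (by omega)
    rw [circleForm_add_left hw, circleForm_C_mul_left, h.circleForm_eq, if_pos rfl,
      h.circleForm_of_degree_lt hw n le_rfl q hq] at ha
    have ha' : a = 0 := by simpa using ha
    subst ha'
    have e : C 0 * φ n + q = q := by simp
    rw [e] at h0 ⊢
    exact ih q hq fun m hm => h0 m (by omega)

/-- Write `φ' n = a φ n + q` with `q` of lower degree. By induction `q` is orthogonal to all earlier
members, hence zero. Then `a` is a quotient of positive leading coefficients with `a² = 1`. -/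
theorem unique (h : IsOrthonormalSystem w φ) (h' : IsOrthonormalSystem w φ')
    (hw : Continuous w) : φ' = φ := by
  funext n
  induction n using Nat.strong_induction_on with
  | _ n ih =>
    have hdeg : (φ' n).degree < (n + 1 : ℕ) := by
      refine degree_le_natDegree.trans_lt ?_
      rw [h'.natDegree_eq]; exact_mod_cast n.lt_succ_self
    obtain ⟨a, q, hq, e⟩ := h.exists_eq_add hdeg
    have hq0 : q = 0 := by
      refine h.eq_zero_of_circleForm hw n q hq fun m hm => ?_
      have h1 := h'.circleForm_eq n m
      rw [ih m hm, e, circleForm_add_left hw, circleForm_C_mul_left, h.circleForm_eq,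
        if_neg hm.ne] at h1
      simpa using h1
    rw [hq0, add_zero] at e
    obtain ⟨κ, hκ, eκ⟩ := h.leadingCoeff_pos n
    obtain ⟨κ', hκ', eκ'⟩ := h'.leadingCoeff_pos n
    have hlc := congrArg leadingCoeff e
    rw [leadingCoeff_mul, leadingCoeff_C, eκ, eκ'] at hlc
    have ha : a = ((κ' / κ : ℝ) : ℂ) := by
      have : (κ : ℂ) ≠ 0 := by exact_mod_cast hκ.ne'
      push_cast; rw [hlc]; field_simp
    have h1 := h'.circleForm_eq n n
    rw [e, circleForm_C_mul_left, circleForm_C_mul_right, h.circleForm_eq, if_pos rfl, ha,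
      Complex.conj_ofReal] at h1
    norm_cast at h1
    have h2 : κ' / κ = 1 := by
      have : 0 < κ' / κ := by positivity
      rw [mul_one] at h1
      nlinarith
    rw [e, ha, h2]
    simp

end IsOrthonormalSystem
end Uniqueness

/-! ### Rotation to the real weight -/

lemma continuous_weight (u : ℂ) : Continuous (weight u) := by
  unfold weight bareWeight
  fun_prop

lemma circlePoint_eq {L : ℝ} (x : ℝ) :
    circlePoint L x = Complex.exp ((2 * (Real.pi * x / L) : ℝ) * Complex.I) := by
  unfold circlePoint
  congr 1; push_cast; ring

/-- In the rotated variable the weight is `2 |cos θ - cos (π x / L)|`. -/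
lemma bareWeight_exp (L x θ : ℝ) : bareWeight (circlePoint L x)
      (Complex.exp ((θ + (Real.pi - Real.pi * x / L) : ℝ) * Complex.I)) =
    2 * |Real.cos θ - Real.cos (Real.pi * x / L)| := by
  rw [circlePoint_eq]
  set α := Real.pi * x / L
  unfold bareWeight
  have e1 : Complex.exp ((θ + (Real.pi - α) : ℝ) * Complex.I) =
      -(Complex.exp (θ * Complex.I) * (starRingEnd ℂ) (Complex.exp (α * Complex.I))) := by
    rw [← Complex.exp_conj, ← Complex.exp_add, map_mul, Complex.conj_I, Complex.conj_ofReal,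
      ← neg_one_mul, ← Complex.exp_pi_mul_I, ← Complex.exp_add]
    congr 1; push_cast; ring
  have e2 : Complex.exp ((2 * α : ℝ) * Complex.I) = Complex.exp (α * Complex.I) ^ 2 := by
    rw [← Complex.exp_nat_mul]; congr 1; push_cast; ring
  have hz := normSq_exp_mul_I θ
  have hg := normSq_exp_mul_I α
  have hz2 := two_cos_eq θ
  have hg2 := two_cos_eq α
  rw [← norm_mul, e1, e2]
  set z := Complex.exp (θ * Complex.I) with hzdef
  set g := Complex.exp (α * Complex.I)
  -- Here the two factors are `1 - z/g` and `1 - gz`, with product `1 - 2z cos α + z²`; dividing by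
  -- `z` gives `2(cos θ - cos α)`.
  have : (1 + -(z * (starRingEnd ℂ) g)) * (1 + g ^ 2 * -(z * (starRingEnd ℂ) g)) =
      z * ((2 * (Real.cos θ - Real.cos α) : ℝ) : ℂ) := by
    push_cast at hz2 hg2 ⊢
    linear_combination (z ^ 2 * (g * (starRingEnd ℂ) g + 1) - g * z) * hg - z * hz2 + z * hg2 - hz
  rw [this, norm_mul, hzdef, Complex.norm_exp_ofReal_mul_I, one_mul, Complex.norm_real,
    Real.norm_eq_abs, abs_mul, abs_two]

lemma circleInt_bareWeight (L x : ℝ) : circleInt (bareWeight (circlePoint L x)) =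
    szegoNorm (cosForm (Real.cos (Real.pi * x / L))) 0 := by
  rw [circleInt_eq_shift _ (Real.pi - Real.pi * x / L)]
  simp only [bareWeight_exp]
  rw [← Complex.ofReal_inj, szegoNorm, cosForm_coe, ← intervalIntegral.integral_ofReal]
  unfold cosIntegral circlePair
  simp [szego]

lemma weight_exp (L x θ : ℝ) : weight (circlePoint L x)
      (Complex.exp ((θ + (Real.pi - Real.pi * x / L) : ℝ) * Complex.I)) =
    2 * |Real.cos θ - Real.cos (Real.pi * x / L)| /
      szegoNorm (cosForm (Real.cos (Real.pi * x / L))) 0 := by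
  rw [weight, normConst, bareWeight_exp, circleInt_bareWeight]
  have := Real.pi_ne_zero
  field_simp

/-- The rotation `e^{iπ(1 - x/L)}` that makes the weight symmetric under conjugation. -/
noncomputable def rotation (L x : ℝ) : ℂ :=
  Complex.exp ((Real.pi - Real.pi * x / L : ℝ) * Complex.I)

lemma rotation_ne_zero (L x : ℝ) : rotation L x ≠ 0 := Complex.exp_ne_zero _

/-- The orthonormal polynomials of the weight, from the Szegő polynomials of the real form. -/
noncomputable def orthoPoly (L x : ℝ) (n : ℕ) : ℂ[X] :=
  C (rotation L x ^ n *
    (Real.sqrt (szegoNorm (cosForm (Real.cos (Real.pi * x / L))) 0 /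
      szegoNorm (cosForm (Real.cos (Real.pi * x / L))) n) : ℝ)) *
  ((szego (cosForm (Real.cos (Real.pi * x / L))) n).map (algebraMap ℝ ℂ)).comp
    (C (rotation L x)⁻¹ * X)

lemma eval_orthoPoly (L x : ℝ) (n : ℕ) (z : ℂ) : (orthoPoly L x n).eval z =
    rotation L x ^ n *
    (Real.sqrt (szegoNorm (cosForm (Real.cos (Real.pi * x / L))) 0 /
      szegoNorm (cosForm (Real.cos (Real.pi * x / L))) n) : ℝ) *
    aeval ((rotation L x)⁻¹ * z) (szego (cosForm (Real.cos (Real.pi * x / L))) n) := by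
  simp [orthoPoly, eval_map_algebraMap]

lemma sqrt_szegoNorm_pos (L x : ℝ) (n : ℕ) :
    0 < Real.sqrt (szegoNorm (cosForm (Real.cos (Real.pi * x / L))) 0 /
      szegoNorm (cosForm (Real.cos (Real.pi * x / L))) n) :=
  Real.sqrt_pos.2 (div_pos ((isToeplitzForm_cosForm _).szegoNorm_pos _)
    ((isToeplitzForm_cosForm _).szegoNorm_pos _))

lemma natDegree_comp_rotation (L x : ℝ) (n : ℕ) :
    (((szego (cosForm (Real.cos (Real.pi * x / L))) n).map (algebraMap ℝ ℂ)).comp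
      (C (rotation L x)⁻¹ * X)).natDegree = n := by
  rw [natDegree_comp, natDegree_map, natDegree_szego,
    natDegree_C_mul_X _ (inv_ne_zero (rotation_ne_zero L x)), mul_one]

/-- The prefactor `rotation L x ^ n` cancels the power produced by rescaling the variable, leaving a
positive number. -/
lemma leadingCoeff_orthoPoly (L x : ℝ) (n : ℕ) : (orthoPoly L x n).leadingCoeff =
    (Real.sqrt (szegoNorm (cosForm (Real.cos (Real.pi * x / L))) 0 /
      szegoNorm (cosForm (Real.cos (Real.pi * x / L))) n) : ℝ) := by
  have h := rotation_ne_zero L x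
  rw [orthoPoly, leadingCoeff_mul, leadingCoeff_C, leadingCoeff_comp, leadingCoeff_map,
    (monic_szego n).leadingCoeff, natDegree_map, natDegree_szego, leadingCoeff_C_mul_X]
  · rw [map_one, one_mul, inv_pow]
    field_simp
  · rw [natDegree_C_mul_X _ (inv_ne_zero h)]
    exact one_ne_zero

theorem isOrthonormalSystem_orthoPoly (L x : ℝ) :
    IsOrthonormalSystem (weight (circlePoint L x)) (orthoPoly L x) where
  natDegree_eq n := by
    have h : rotation L x ^ n *
        (Real.sqrt (szegoNorm (cosForm (Real.cos (Real.pi * x / L))) 0 /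
          szegoNorm (cosForm (Real.cos (Real.pi * x / L))) n) : ℝ) ≠ 0 :=
      mul_ne_zero (pow_ne_zero _ (rotation_ne_zero L x))
        (by exact_mod_cast (sqrt_szegoNorm_pos L x n).ne')
    rw [orthoPoly, natDegree_C_mul h, natDegree_comp_rotation]
  leadingCoeff_pos n := ⟨_, sqrt_szegoNorm_pos L x n, leadingCoeff_orthoPoly L x n⟩
  orthonormal n m := by
    have hB := isToeplitzForm_cosForm (Real.cos (Real.pi * x / L))
    have hrot : ∀ θ : ℝ, (rotation L x)⁻¹ *
        Complex.exp ((θ + (Real.pi - Real.pi * x / L) : ℝ) * Complex.I) =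
          Complex.exp (θ * Complex.I) := by
      intro θ
      rw [rotation, ← Complex.exp_neg, ← Complex.exp_add]
      congr 1; push_cast; ring
    rw [circleInt_eq_shift _ (Real.pi - Real.pi * x / L)]
    simp only [weight_exp, eval_orthoPoly, hrot]
    set B := cosForm (Real.cos (Real.pi * x / L)) with hBdef
    -- The normalised weight carries a factor `1/h_0`, which is why the normalising constants are
    -- `√(h_0/h_n)`.
    have key : ∫ θ in (0 : ℝ)..(2 * Real.pi),
        ((2 * |Real.cos θ - Real.cos (Real.pi * x / L)| / szegoNorm B 0 : ℝ) : ℂ) *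
          (rotation L x ^ n * (Real.sqrt (szegoNorm B 0 / szegoNorm B n) : ℝ) *
            aeval (Complex.exp (θ * Complex.I)) (szego B n)) *
          (starRingEnd ℂ) (rotation L x ^ m * (Real.sqrt (szegoNorm B 0 / szegoNorm B m) : ℝ) *
            aeval (Complex.exp (θ * Complex.I)) (szego B m)) =
        (rotation L x ^ n * (starRingEnd ℂ) (rotation L x ^ m)) *
          ((Real.sqrt (szegoNorm B 0 / szegoNorm B n) * Real.sqrt (szegoNorm B 0 / szegoNorm B m) /
            szegoNorm B 0 * B (szego B n) (szego B m) : ℝ) : ℂ) := by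
      rw [Complex.ofReal_mul, hBdef, cosForm_coe, ← hBdef, cosIntegral, ← mul_assoc,
        ← intervalIntegral.integral_const_mul]
      congr 1; ext θ
      simp only [map_mul, Complex.conj_ofReal, circlePair]
      push_cast
      ring
    rw [key]
    by_cases hmn : m = n
    · subst hmn
      have h0 := hB.szegoNorm_pos 0
      have hm := hB.szegoNorm_pos m
      have h1 : rotation L x ^ m * (starRingEnd ℂ) (rotation L x ^ m) = 1 := by
        rw [map_pow, ← mul_pow, rotation, normSq_exp_mul_I, one_pow]
      rw [if_pos rfl, h1, Real.mul_self_sqrt (by positivity)]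
      change 1 * ((szegoNorm B 0 / szegoNorm B m / szegoNorm B 0 * szegoNorm B m : ℝ) : ℂ) = 1
      rw [one_mul]
      norm_cast
      field_simp
    · rw [if_neg hmn, hB.szego_szego (Ne.symm hmn)]
      simp

/-- Rescaling the variable does not affect the value at `0`, so the prefactor `rotation L x ^ n`
survives there as the phase. -/
theorem reflCoeff_eq {L x : ℝ} {φ : ℕ → ℂ[X]}
    (h : IsOrthonormalSystem (weight (circlePoint L x)) φ) (n : ℕ) :
    reflCoeff φ n = Complex.exp (Complex.I * Real.pi * (1 - x / L) * n) *
      (verblunsky (cosForm (Real.cos (Real.pi * x / L))) n : ℂ) := by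
  rw [(isOrthonormalSystem_orthoPoly L x).unique h (continuous_weight _), reflCoeff,
    leadingCoeff_orthoPoly, eval_orthoPoly, mul_zero]
  have hs : ((Real.sqrt (szegoNorm (cosForm (Real.cos (Real.pi * x / L))) 0 /
      szegoNorm (cosForm (Real.cos (Real.pi * x / L))) n) : ℝ) : ℂ) ≠ 0 := by
    exact_mod_cast (sqrt_szegoNorm_pos L x n).ne'
  have hr : rotation L x ^ n = Complex.exp (Complex.I * Real.pi * (1 - x / L) * n) := by
    rw [rotation, ← Complex.exp_nat_mul]
    congr 1; push_cast; ring
  have hv : aeval (0 : ℂ) (szego (cosForm (Real.cos (Real.pi * x / L))) n) =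
      (verblunsky (cosForm (Real.cos (Real.pi * x / L))) n : ℂ) := by
    rw [← coeff_zero_eq_aeval_zero', verblunsky]
    rfl
  rw [hv, hr]
  field_simp

theorem existsUnique_orthonormalSystem (L x : ℝ) :
    ∃! φ : ℕ → ℂ[X], IsOrthonormalSystem (weight (circlePoint L x)) φ :=
  ⟨orthoPoly L x, isOrthonormalSystem_orthoPoly L x, fun _ h =>
    (isOrthonormalSystem_orthoPoly L x).unique h (continuous_weight _)⟩

lemma norm_reflCoeff {L x : ℝ} {φ : ℕ → ℂ[X]}
    (h : IsOrthonormalSystem (weight (circlePoint L x)) φ) (n : ℕ) :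
    ‖reflCoeff φ n‖ ^ 2 = verblunsky (cosForm (Real.cos (Real.pi * x / L))) n ^ 2 := by
  have : Complex.I * Real.pi * (1 - x / L) * n =
      ((Real.pi * (1 - x / L) * n : ℝ) : ℂ) * Complex.I := by
    push_cast; ring
  rw [reflCoeff_eq h, norm_mul, this, Complex.norm_exp_ofReal_mul_I, one_mul, Complex.norm_real,
    Real.norm_eq_abs, sq_abs]

/-! ### Density matrices through Heine's formula -/

lemma norm_exp_sub_exp (a b : ℝ) :
    ‖Complex.exp (a * Complex.I) - Complex.exp (b * Complex.I)‖ =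
      2 * |Real.sin ((a - b) / 2)| := by
  have : Complex.exp (a * Complex.I) - Complex.exp (b * Complex.I) =
      Complex.exp (b * Complex.I) * (Complex.exp (Complex.I * ((a - b : ℝ) : ℂ)) - 1) := by
    rw [mul_sub, ← Complex.exp_add, mul_one]
    congr 2; push_cast; ring
  rw [this, norm_mul, Complex.norm_exp_ofReal_mul_I, one_mul,
    Complex.norm_exp_I_mul_ofReal_sub_one, Real.norm_eq_abs, abs_mul, abs_two]

/-- The angle of the rotated variable at the position `t` on the circle. -/
noncomputable def angle (L x t : ℝ) : ℝ := 2 * Real.pi / L * t - Real.pi * x / L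

lemma continuous_angle (L x : ℝ) : Continuous (angle L x) := by
  unfold angle; fun_prop

/-- The product formula for a difference of cosines merges the factors pairing `t i` with `x` and
with `0` into the weight. The remaining factors are chord lengths, each occurring twice. -/
lemma psiC_mul_psiC {L : ℝ} (hL : 0 < L) (x : ℝ) {N : ℕ} (t : Fin N → ℝ) :
    psiC L (Fin.cons x t : Fin (N + 1) → ℝ) * psiC L (Fin.cons 0 t : Fin (N + 1) → ℝ) =
      (L ^ (N + 1) * (N + 1).factorial)⁻¹ *
        ((∏ i, 2 * |Real.cos (angle L x (t i)) - Real.cos (Real.pi * x / L)|) *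
          ‖(Matrix.vandermonde fun i =>
            Complex.exp ((angle L x (t i) : ℝ) * Complex.I)).det‖ ^ 2) := by
  have e1 : ∀ s : ℝ, 2 * |Real.cos (angle L x s) - Real.cos (Real.pi * x / L)| =
      (2 * |Real.sin (Real.pi * (s - x) / L)|) * (2 * |Real.sin (Real.pi * (s - 0) / L)|) := by
    intro s
    rw [Real.cos_sub_cos, abs_mul, abs_mul, abs_neg, abs_two]
    have h1 : (angle L x s + Real.pi * x / L) / 2 = Real.pi * (s - 0) / L := by
      unfold angle; field_simp; ring
    have h2 : (angle L x s - Real.pi * x / L) / 2 = Real.pi * (s - x) / L := by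
      unfold angle; field_simp; ring
    rw [h1, h2]; ring
  have e2 : ∀ i k : Fin N, ‖Complex.exp ((angle L x (t k) : ℝ) * Complex.I) -
      Complex.exp ((angle L x (t i) : ℝ) * Complex.I)‖ =
        2 * |Real.sin (Real.pi * (t k - t i) / L)| := by
    intro i k
    rw [norm_exp_sub_exp]
    have : (angle L x (t k) - angle L x (t i)) / 2 = Real.pi * (t k - t i) / L := by
      unfold angle; field_simp; ring
    rw [this]
  rw [Matrix.det_vandermonde, norm_prod]
  simp only [norm_prod, e1, e2, psiC, Fin.prod_univ_succ, Fin.prod_Ioi_zero, Fin.prod_Ioi_succ,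
    Fin.cons_zero, Fin.cons_succ, Finset.prod_mul_distrib]
  have h1 : (Real.sqrt (L ^ (N + 1)))⁻¹ * (Real.sqrt (L ^ (N + 1)))⁻¹ = (L ^ (N + 1))⁻¹ := by
    rw [← mul_inv, Real.mul_self_sqrt (by positivity)]
  have h2 : (Real.sqrt ((N + 1).factorial : ℝ))⁻¹ * (Real.sqrt ((N + 1).factorial : ℝ))⁻¹ =
      ((N + 1).factorial : ℝ)⁻¹ := by
    rw [← mul_inv, Real.mul_self_sqrt (by positivity)]
  rw [mul_inv, ← h1, ← h2]
  ring

lemma integral_comp_angle {L : ℝ} (hL : 0 < L) (x : ℝ) (p q : ℝ[X]) :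
    ∫ t in Icc (0 : ℝ) L,
      ((2 * |Real.cos (angle L x t) - Real.cos (Real.pi * x / L)| : ℝ) : ℂ) *
        circlePair p q (angle L x t) =
      ((L / (2 * Real.pi) * cosForm (Real.cos (Real.pi * x / L)) p q : ℝ) : ℂ) := by
  have hpi := Real.pi_pos
  set F : ℝ → ℂ := fun θ =>
    ((2 * |Real.cos θ - Real.cos (Real.pi * x / L)| : ℝ) : ℂ) * circlePair p q θ with hF
  have hper : Function.Periodic F (2 * Real.pi) := by
    intro θ
    have : Complex.exp (((θ + 2 * Real.pi : ℝ) : ℂ) * Complex.I) = Complex.exp (θ * Complex.I) := by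
      push_cast
      rw [add_mul, Complex.exp_add, Complex.exp_two_pi_mul_I, mul_one]
    simp only [hF, circlePair, this, Real.cos_add_two_pi]
  have hc : 2 * Real.pi / L ≠ 0 := by positivity
  rw [integral_Icc_eq_integral_Ioc, ← intervalIntegral.integral_of_le hL.le]
  have h := intervalIntegral.integral_comp_mul_sub (a := 0) (b := L) F hc (Real.pi * x / L)
  change ∫ t in (0 : ℝ)..L, F (2 * Real.pi / L * t - Real.pi * x / L) = _
  rw [h]
  have e : 2 * Real.pi / L * L - Real.pi * x / L =
      2 * Real.pi / L * 0 - Real.pi * x / L + 2 * Real.pi := by field_simp; ring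
  rw [e, hper.intervalIntegral_add_eq _ 0, zero_add, Complex.ofReal_mul, cosForm_coe,
    Complex.real_smul, inv_div]
  rfl

/-- Column operations replace the powers in the Vandermonde determinant by any monic polynomials;
the determinant and its conjugate are then expanded by Leibniz. -/
lemma norm_sq_det_eq_sum {N : ℕ} (θ : Fin N → ℝ) (p : ℕ → ℝ[X])
    (hdeg : ∀ n, (p n).natDegree = n) (hmonic : ∀ n, (p n).Monic) :
    ((‖(Matrix.vandermonde fun i => Complex.exp (θ i * Complex.I)).det‖ ^ 2 : ℝ) : ℂ) =
      ∑ σ : Equiv.Perm (Fin N), ∑ τ : Equiv.Perm (Fin N),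
        (((Equiv.Perm.sign σ : ℤ) * (Equiv.Perm.sign τ : ℤ) : ℤ) : ℂ) *
          ∏ i, circlePair (p (σ i)) (p (τ i)) (θ i) := by
  rw [Matrix.det_eval_matrixOfPolynomials_eq_det_vandermonde _
    (fun j : Fin N => (p j).map (algebraMap ℝ ℂ)) (fun i => by rw [natDegree_map, hdeg])
    (fun i => (hmonic i).map _)]
  rw [← Complex.normSq_eq_norm_sq, ← Complex.mul_conj, ← Matrix.det_transpose, Matrix.det_apply,
    map_sum, Finset.sum_mul_sum]
  refine Finset.sum_congr rfl fun σ _ => Finset.sum_congr rfl fun τ _ => ?_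
  simp only [Matrix.transpose_apply, Matrix.of_apply, eval_map_algebraMap, circlePair,
    Finset.prod_mul_distrib, Units.smul_def, zsmul_eq_mul, map_mul, map_prod, map_intCast]
  push_cast
  ring

/-- Heine's formula for the weight `2 |cos θ - cos (π x / L)|`. -/
lemma integral_vandermonde {L : ℝ} (hL : 0 < L) (x : ℝ) (N : ℕ) :
    ∫ t in Set.univ.pi (fun _ : Fin N => Icc (0 : ℝ) L),
      (∏ i, 2 * |Real.cos (angle L x (t i)) - Real.cos (Real.pi * x / L)|) *
        ‖(Matrix.vandermonde fun i =>
          Complex.exp ((angle L x (t i) : ℝ) * Complex.I)).det‖ ^ 2 =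
      N.factorial * ∏ j ∈ Finset.range N,
        (L / (2 * Real.pi) * szegoNorm (cosForm (Real.cos (Real.pi * x / L))) j) := by
  have hB := isToeplitzForm_cosForm (Real.cos (Real.pi * x / L))
  set B := cosForm (Real.cos (Real.pi * x / L)) with hBdef
  set G : ℕ → ℕ → ℝ → ℂ := fun m n s =>
    ((2 * |Real.cos (angle L x s) - Real.cos (Real.pi * x / L)| : ℝ) : ℂ) *
      circlePair (szego B m) (szego B n) (angle L x s) with hG
  have hGint : ∀ m n, Integrable (G m n) ((volume : Measure ℝ).restrict (Icc 0 L)) := by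
    intro m n
    have h1 := continuous_angle L x
    have h2 := (continuous_circlePair (szego B m) (szego B n)).comp h1
    have h3 : Continuous (G m n) := by
      refine Continuous.mul ?_ h2
      fun_prop
    exact h3.continuousOn.integrableOn_compact isCompact_Icc
  have hval : ∀ m n, ∫ s in Icc (0 : ℝ) L, G m n s =
      if m = n then ((L / (2 * Real.pi) * szegoNorm B m : ℝ) : ℂ) else 0 := by
    intro m n
    rw [hG]
    simp only
    rw [integral_comp_angle hL, ← hBdef]
    split_ifs with h
    · rw [h]; rfl
    · rw [hB.szego_szego h]; simp
  rw [← Complex.ofReal_inj, ← integral_complex_ofReal, volume_pi, Measure.restrict_pi_pi]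
  have hpt : ∀ t : Fin N → ℝ,
      (((∏ i, 2 * |Real.cos (angle L x (t i)) - Real.cos (Real.pi * x / L)|) *
        ‖(Matrix.vandermonde fun i =>
          Complex.exp ((angle L x (t i) : ℝ) * Complex.I)).det‖ ^ 2 : ℝ) : ℂ) =
      ∑ σ : Equiv.Perm (Fin N), ∑ τ : Equiv.Perm (Fin N),
        (((Equiv.Perm.sign σ : ℤ) * (Equiv.Perm.sign τ : ℤ) : ℤ) : ℂ) *
          ∏ i, G (σ i) (τ i) (t i) := by
    intro t
    rw [Complex.ofReal_mul, norm_sq_det_eq_sum (fun i => angle L x (t i)) (szego B) natDegree_szego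
      monic_szego, Finset.mul_sum]
    refine Finset.sum_congr rfl fun σ _ => ?_
    rw [Finset.mul_sum]
    refine Finset.sum_congr rfl fun τ _ => ?_
    rw [hG]
    simp only [Finset.prod_mul_distrib]
    push_cast [Finset.prod_mul_distrib]
    ring
  have hint : ∀ σ τ : Equiv.Perm (Fin N), Integrable (fun t : Fin N → ℝ =>
      (((Equiv.Perm.sign σ : ℤ) * (Equiv.Perm.sign τ : ℤ) : ℤ) : ℂ) *
        ∏ i, G (σ i) (τ i) (t i))
      (Measure.pi fun _ => (volume : Measure ℝ).restrict (Icc 0 L)) := fun σ τ =>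
    (Integrable.fintype_prod fun i => hGint (σ i) (τ i)).const_mul _
  -- Fubini splits the integral into one-variable pairings. If `σ ≠ τ`, one of them vanishes by
  -- orthogonality; the diagonal terms are all equal, which produces the factor `N!`.
  have hterm : ∀ σ τ : Equiv.Perm (Fin N), ∫ t : Fin N → ℝ,
      (((Equiv.Perm.sign σ : ℤ) * (Equiv.Perm.sign τ : ℤ) : ℤ) : ℂ) *
        ∏ i, G (σ i) (τ i) (t i)
      ∂(Measure.pi fun _ => (volume : Measure ℝ).restrict (Icc 0 L)) =
      if σ = τ then ∏ j : Fin N, ((L / (2 * Real.pi) * szegoNorm B j : ℝ) : ℂ) else 0 := by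
    intro σ τ
    rw [integral_const_mul,
      integral_fintype_prod_eq_prod (fun (i : Fin N) s => G (σ i) (τ i) s)]
    simp only [hval]
    split_ifs with h
    · subst h
      simp only [if_true]
      rw [Equiv.prod_comp σ (fun j : Fin N => ((L / (2 * Real.pi) * szegoNorm B j : ℝ) : ℂ)),
        ← Units.val_mul, Int.units_mul_self]
      simp
    · obtain ⟨i, hi⟩ : ∃ i, σ i ≠ τ i := by
        by_contra! hc
        exact h (Equiv.ext hc)
      rw [Finset.prod_eq_zero (Finset.mem_univ i), mul_zero]
      rw [if_neg (fun hc => hi (Fin.ext hc))]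
  simp only [hpt]
  rw [integral_finsetSum _ fun σ _ => integrable_finsetSum _ fun τ _ => hint σ τ]
  simp only [integral_finsetSum _ fun τ _ => hint _ τ, hterm]
  simp [Fintype.card_perm, Finset.prod_range]

/-- The `N!` of Heine's formula and the factor `N + 1` cancel `(N + 1)!`, and the Jacobians leave a
single `1/L`. -/
theorem rhoC_eq {L : ℝ} (hL : 0 < L) (x : ℝ) (N : ℕ) :
    rhoC L (N + 1) x 0 = 1 / L * ∏ j ∈ Finset.range N,
      (szegoNorm (cosForm (Real.cos (Real.pi * x / L))) j / (2 * Real.pi)) := by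
  simp only [rhoC, psiC_mul_psiC hL]
  rw [integral_const_mul, integral_vandermonde hL]
  have h : ∀ j, L / (2 * Real.pi) * szegoNorm (cosForm (Real.cos (Real.pi * x / L))) j =
      L * (szegoNorm (cosForm (Real.cos (Real.pi * x / L))) j / (2 * Real.pi)) := by
    intro j; ring
  simp only [h]
  rw [Finset.prod_mul_distrib, Finset.prod_const, Finset.card_range, Nat.factorial_succ]
  have := N.factorial_ne_zero
  push_cast
  field_simp
  ring

lemma rhoC_succ {L : ℝ} (hL : 0 < L) (x : ℝ) (N : ℕ) :
    rhoC L (N + 2) x 0 = rhoC L (N + 1) x 0 *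
      (szegoNorm (cosForm (Real.cos (Real.pi * x / L))) N / (2 * Real.pi)) := by
  rw [rhoC_eq hL x (N + 1), rhoC_eq hL x N, Finset.prod_range_succ, mul_assoc]

lemma rhoC_pos {L : ℝ} (hL : 0 < L) (x : ℝ) {N : ℕ} (hN : 1 ≤ N) : 0 < rhoC L N x 0 := by
  obtain ⟨N, rfl⟩ := Nat.exists_eq_add_of_le' hN
  rw [rhoC_eq hL]
  have := Real.pi_pos
  refine mul_pos (by positivity) (Finset.prod_pos fun j _ => ?_)
  exact div_pos ((isToeplitzForm_cosForm _).szegoNorm_pos j) (by positivity)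

theorem rhoC_recurrence {L : ℝ} (hL : 0 < L) (x : ℝ) {N : ℕ} (hN : 1 ≤ N) :
    rhoC L (N + 2) x 0 * rhoC L N x 0 =
      (1 - verblunsky (cosForm (Real.cos (Real.pi * x / L))) N ^ 2) *
        rhoC L (N + 1) x 0 ^ 2 := by
  obtain ⟨N, rfl⟩ := Nat.exists_eq_add_of_le' hN
  rw [rhoC_succ hL x (N + 1), rhoC_succ hL x N, (isToeplitzForm_cosForm _).szegoNorm_succ]
  ring

/-! ### Initial values -/

lemma rhoC_one {L : ℝ} (hL : 0 < L) (x : ℝ) : rhoC L 1 x 0 = 1 / L := by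
  rw [rhoC_eq hL x 0]; simp

lemma szegoNorm_zero_cosForm {α : ℝ} (h0 : 0 ≤ α) (hpi : α ≤ Real.pi) :
    szegoNorm (cosForm (Real.cos α)) 0 =
      8 * ((Real.pi / 2 - α) * Real.cos α + Real.sin α) := by
  rw [← cosForm_one_one h0 hpi]; rfl

lemma mem_Icc_pi {L x : ℝ} (hL : 0 < L) (hx : x ∈ Icc 0 L) :
    Real.pi * x / L ∈ Icc 0 Real.pi := by
  have hpi := Real.pi_pos
  refine ⟨div_nonneg (mul_nonneg hpi.le hx.1) hL.le, ?_⟩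
  rw [div_le_iff₀ hL]
  exact mul_le_mul_of_nonneg_left hx.2 hpi.le

lemma verblunsky_one {α : ℝ} (hα : α ∈ Icc 0 Real.pi) :
    verblunsky (cosForm (Real.cos α)) 1 =
      (Real.pi - 2 * α + Real.sin (2 * α)) /
        (4 * ((Real.pi / 2 - α) * Real.cos α + Real.sin α)) := by
  rw [verblunsky_succ]
  simp only [szego, mul_one]
  rw [cosForm_X_one hα.1 hα.2, cosForm_one_one hα.1 hα.2, neg_neg,
    show (8 : ℝ) * ((Real.pi / 2 - α) * Real.cos α + Real.sin α) =
      2 * (4 * ((Real.pi / 2 - α) * Real.cos α + Real.sin α)) by ring,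
    mul_div_mul_left _ _ two_ne_zero]

lemma cosForm_one_one_pos {α : ℝ} (hα : α ∈ Icc 0 Real.pi) :
    0 < (Real.pi / 2 - α) * Real.cos α + Real.sin α := by
  have h := (isToeplitzForm_cosForm (Real.cos α)).szegoNorm_pos 0
  rw [szegoNorm_zero_cosForm hα.1 hα.2] at h
  linarith

lemma verblunsky_one_eq_initOne {L x : ℝ} (hL : 0 < L) (hx : x ∈ Icc 0 L) :
    verblunsky (cosForm (Real.cos (Real.pi * x / L))) 1 = initOne L x := by
  have hα := mem_Icc_pi hL hx
  have h0 := (cosForm_one_one_pos hα).ne'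
  rw [verblunsky_one hα, initOne, show 2 * Real.pi * x / L = 2 * (Real.pi * x / L) by ring]
  set α := Real.pi * x / L
  have h1 : 1 / 2 * (Real.pi - 2 * α) * Real.cos α + Real.sin α =
      (Real.pi / 2 - α) * Real.cos α + Real.sin α := by ring
  rw [h1]
  field_simp

lemma rhoC_two {L x : ℝ} (hL : 0 < L) (hx : x ∈ Icc 0 L) : rhoC L 2 x 0 =
    4 / (Real.pi * L) * (Real.pi * (1 / 2 - x / L) * Real.cos (Real.pi * x / L)
      + Real.sin (Real.pi * x / L)) := by
  have hα := mem_Icc_pi hL hx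
  have hpi := Real.pi_ne_zero
  rw [rhoC_eq hL x 1, Finset.prod_range_one, szegoNorm_zero_cosForm hα.1 hα.2]
  field_simp
  ring

/-! ### Analyticity and zeros -/

/-- The recurrence solved for the next coefficient. -/
lemma verblunsky_add_two (c : ℝ) (n : ℕ) :
    verblunsky (cosForm c) (n + 2) =
      (2 * verblunsky (cosForm c) (n + 1) * (c * (n + 1) + (szego (cosForm c) (n + 1)).coeff n) /
        (1 - verblunsky (cosForm c) (n + 1) ^ 2) - (n + 1) * verblunsky (cosForm c) n) /
        (n + 3) := by
  have h := verblunsky_pearson (isToeplitzForm_cosForm c) (isPearson_cosForm c) n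
  have h1 := ((isToeplitzForm_cosForm c).one_sub_verblunsky_sq_pos n).ne'
  have h3 : (n : ℝ) + 3 ≠ 0 := by positivity
  rw [← h]
  field_simp
  ring

lemma coeff_szego_add_two (c : ℝ) (n : ℕ) : (szego (cosForm c) (n + 2)).coeff (n + 1) =
    (szego (cosForm c) (n + 1)).coeff n +
      verblunsky (cosForm c) (n + 2) * verblunsky (cosForm c) (n + 1) := by
  rw [coeff_szego_succ, if_neg n.succ_ne_zero, Nat.add_sub_cancel]

/-- The endpoint `α = 0` supplies a point where no coefficient vanishes. The induction also carries
`l_{n+1} = (n+1)/(n+2)`, which the recurrence needs. -/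
lemma verblunsky_cosForm_one (n : ℕ) : verblunsky (cosForm 1) n = 1 / (n + 1) := by
  suffices h : verblunsky (cosForm 1) n = 1 / (n + 1) ∧
      verblunsky (cosForm 1) (n + 1) = 1 / (n + 2) ∧
      (szego (cosForm 1) (n + 1)).coeff n = (n + 1) / (n + 2) from h.1
  induction n with
  | zero =>
    have h1 : verblunsky (cosForm 1) 1 = 1 / 2 := by
      have := verblunsky_one (α := 0) ⟨le_rfl, Real.pi_pos.le⟩
      rw [Real.cos_zero] at this
      rw [this]
      simp
      field_simp
      norm_num
    refine ⟨by simp [verblunsky_zero], by simp [h1], ?_⟩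
    rw [coeff_szego_succ]
    simp [h1, verblunsky_zero]
  | succ n ih =>
    obtain ⟨h0, h1, h2⟩ := ih
    have e : verblunsky (cosForm 1) (n + 2) = 1 / (n + 3) := by
      rw [verblunsky_add_two, h0, h1, h2]
      have a1 : (n : ℝ) + 1 ≠ 0 := by positivity
      have a2 : (n : ℝ) + 2 ≠ 0 := by positivity
      have a3 : (n : ℝ) + 3 ≠ 0 := by positivity
      have a4 : (1 : ℝ) - (1 / (n + 2)) ^ 2 = (n + 1) * (n + 3) / (n + 2) ^ 2 := by
        field_simp; ring
      rw [a4]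
      field_simp
      ring
    refine ⟨?_, ?_, ?_⟩
    · rw [h1]; push_cast; congr 1; ring
    · rw [e]; push_cast; congr 1; ring
    · rw [coeff_szego_add_two, h2, e, h1]
      push_cast
      have a2 : (n : ℝ) + 2 ≠ 0 := by positivity
      have a3 : (n : ℝ) + 3 ≠ 0 := by positivity
      have a4 : (n : ℝ) + 1 + 2 ≠ 0 := by positivity
      field_simp
      ring

/-- The coefficients extend to functions analytic near `[0, π]`. -/
lemma exists_analyticOnNhd_verblunsky (n : ℕ) : ∃ f : ℝ → ℝ,
    AnalyticOnNhd ℝ f (Icc 0 Real.pi) ∧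
      EqOn f (fun α => verblunsky (cosForm (Real.cos α)) n) (Icc 0 Real.pi) := by
  -- Two consecutive coefficients and `l` are continued together, so the only coefficient-dependent
  -- divisor is `1 - r̃²`. Separate functions are used because the closed form of `r̃_1` is
  -- established only on `[0, π]`.
  suffices h : (∃ f : ℝ → ℝ, AnalyticOnNhd ℝ f (Icc 0 Real.pi) ∧
      EqOn f (fun α => verblunsky (cosForm (Real.cos α)) n) (Icc 0 Real.pi)) ∧
      (∃ g : ℝ → ℝ, AnalyticOnNhd ℝ g (Icc 0 Real.pi) ∧
      EqOn g (fun α => verblunsky (cosForm (Real.cos α)) (n + 1)) (Icc 0 Real.pi)) ∧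
      (∃ l : ℝ → ℝ, AnalyticOnNhd ℝ l (Icc 0 Real.pi) ∧
      EqOn l (fun α => (szego (cosForm (Real.cos α)) (n + 1)).coeff n) (Icc 0 Real.pi)) from h.1
  have hcos : AnalyticOnNhd ℝ Real.cos (Icc 0 Real.pi) := fun x _ => Real.analyticAt_cos
  induction n with
  | zero =>
    have hg : AnalyticOnNhd ℝ (fun α => (Real.pi - 2 * α + Real.sin (2 * α)) /
        (4 * ((Real.pi / 2 - α) * Real.cos α + Real.sin α))) (Icc 0 Real.pi) := by
      intro α hα
      have h := cosForm_one_one_pos hα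
      have h1 : AnalyticAt ℝ (fun α => Real.pi - 2 * α + Real.sin (2 * α)) α :=
        by fun_prop
      have h2 : AnalyticAt ℝ
          (fun α => 4 * ((Real.pi / 2 - α) * Real.cos α + Real.sin α)) α := by fun_prop
      exact h1.div h2 (by positivity)
    refine ⟨⟨fun _ => 1, analyticOnNhd_const, fun α _ => by simp [verblunsky_zero]⟩,
      ⟨_, hg, fun α hα => (verblunsky_one hα).symm⟩, ⟨_, hg, fun α hα => ?_⟩⟩
    simp only
    rw [coeff_szego_succ, if_pos rfl, zero_add, verblunsky_zero, mul_one, verblunsky_one hα]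
  | succ n ih =>
    obtain ⟨⟨f, hf, ef⟩, ⟨g, hg, eg⟩, ⟨l, hl, el⟩⟩ := ih
    have hk : ∃ k : ℝ → ℝ, AnalyticOnNhd ℝ k (Icc 0 Real.pi) ∧
        EqOn k (fun α => verblunsky (cosForm (Real.cos α)) (n + 2)) (Icc 0 Real.pi) := by
      refine ⟨fun α => (2 * g α * (Real.cos α * (n + 1) + l α) / (1 - g α ^ 2) - (n + 1) * f α) /
        (n + 3), fun α hα => ?_, fun α hα => ?_⟩
      · have h1 := hf α hα
        have h2 := hg α hα
        have h3 := hl α hα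
        have h4 := hcos α hα
        have hne : 1 - g α ^ 2 ≠ 0 := by
          rw [eg hα]
          exact ((isToeplitzForm_cosForm _).one_sub_verblunsky_sq_pos n).ne'
        have hn : (n : ℝ) + 3 ≠ 0 := by positivity
        have h5 : AnalyticAt ℝ (fun α => 2 * g α * (Real.cos α * (n + 1) + l α)) α := by fun_prop
        have h6 : AnalyticAt ℝ (fun α => 1 - g α ^ 2) α := by fun_prop
        have h7 : AnalyticAt ℝ (fun α => ((n : ℝ) + 1) * f α) α := by fun_prop
        exact ((h5.div h6 hne).sub h7).div analyticAt_const hn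
      · simp only
        rw [verblunsky_add_two, ef hα, eg hα, el hα]
    obtain ⟨k, hk, ek⟩ := hk
    refine ⟨⟨g, hg, eg⟩, ⟨k, hk, ek⟩, ⟨fun α => l α + k α * g α, hl.add (hk.mul hg),
      fun α hα => ?_⟩⟩
    simp only
    rw [coeff_szego_add_two, ek hα, eg hα, el hα]

lemma continuousOn_verblunsky (n : ℕ) :
    ContinuousOn (fun α => verblunsky (cosForm (Real.cos α)) n) (Icc 0 Real.pi) := by
  obtain ⟨f, hf, ef⟩ := exists_analyticOnNhd_verblunsky n
  exact hf.continuousOn.congr ef.symm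

/-- Infinitely many zeros would accumulate in the compact interval and force the analytic extension
to vanish identically there, including at `α = 0`. -/
lemma finite_zeros_verblunsky (n : ℕ) :
    {α ∈ Icc 0 Real.pi | verblunsky (cosForm (Real.cos α)) n = 0}.Finite := by
  obtain ⟨f, hf, ef⟩ := exists_analyticOnNhd_verblunsky n
  by_contra hinf
  obtain ⟨z, hz, hacc⟩ := Set.Infinite.exists_accPt_of_subset_isCompact hinf isCompact_Icc
    (fun α hα => hα.1)
  have hfreq := accPt_iff_frequently_nhdsNE.1 hacc
  have h0 := hf.eqOn_zero_of_preconnected_of_frequently_eq_zero isPreconnected_Icc hz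
    (hfreq.mono fun α hα => by rw [ef hα.1]; exact hα.2)
  have hmem : (0 : ℝ) ∈ Icc 0 Real.pi := ⟨le_rfl, Real.pi_pos.le⟩
  have h1 := (ef hmem).symm.trans (h0 hmem)
  simp only [Real.cos_zero, verblunsky_cosForm_one, Pi.zero_apply] at h1
  have : (0 : ℝ) < 1 / (n + 1) := by positivity
  linarith

/-! ### Determination by the difference equation -/

lemma diffEq_of_cleared {c : ℝ} {s : ℕ → ℝ} {N : ℕ} (h : DiffEqCleared c s N) (h0 : s N ≠ 0)
    (h1 : s (N + 1) ≠ 0) : DiffEq c s N := by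
  unfold DiffEq
  unfold DiffEqCleared at h
  apply mul_right_cancel₀ (mul_ne_zero h0 h1)
  rw [h]
  field_simp

/-- The cleared equation is linear in its newest term, with coefficient `(1 - r_{n+1}²) r_n (n + 3)
≠ 0`. -/
lemma eq_of_diffEqCleared {c : ℝ} {r s : ℕ → ℝ} (h0 : s 0 = r 0) (h1 : s 1 = r 1)
    (hlt : ∀ n, 1 - r (n + 1) ^ 2 ≠ 0) (hr : ∀ n, DiffEqCleared c r n) {N : ℕ}
    (hne : ∀ n ≤ N, r n ≠ 0) (hs : ∀ n ≤ N, DiffEqCleared c s n) :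
    ∀ n ≤ N + 2, s n = r n := by
  intro n
  induction n using Nat.strong_induction_on with
  | _ n ih =>
    intro hn
    rcases n with _ | _ | n
    · exact h0
    · exact h1
    · have e0 := ih n (by omega) (by omega)
      have e1 := ih (n + 1) (by omega) (by omega)
      -- At `n = 0` truncated subtraction gives index `0`; that term has factor `n = 0` anyway.
      have e2 : s (n - 1) = r (n - 1) := ih (n - 1) (by omega) (by omega)
      have hs' := hs n (by omega)
      have hr' := hr n
      unfold DiffEqCleared at hs' hr'
      rw [e0, e1, e2] at hs'
      have hn3 : (n : ℝ) + 3 ≠ 0 := by positivity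
      apply mul_left_cancel₀ (mul_ne_zero (mul_ne_zero (hlt n) (hne n (by omega))) hn3)
      linear_combination hr' - hs'

end ImpenetrableBose

open ImpenetrableBose
theorem proposition4 (L : ℝ) (hL : 0 < L) :
    -- for every `x` the orthonormal polynomials exist and are unique
    (∀ x ∈ Icc (0 : ℝ) L,
      ∃! φ : ℕ → ℂ[X], IsOrthonormalSystem (weight (circlePoint L x)) φ) ∧
    ∀ φ : ℝ → ℕ → ℂ[X],
      (∀ x ∈ Icc (0 : ℝ) L, IsOrthonormalSystem (weight (circlePoint L x)) (φ x)) →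
      -- the density matrices are positive, and their quotients give `1 - |r_N|^2`
      (∀ x ∈ Icc (0 : ℝ) L, ∀ N : ℕ, 1 ≤ N → 0 < rhoC L N x 0) ∧
      (∀ x ∈ Icc (0 : ℝ) L, ∀ N : ℕ, 1 ≤ N →
        1 - ‖reflCoeff (φ x) N‖ ^ 2 =
          rhoC L (N + 2) x 0 * rhoC L N x 0 / rhoC L (N + 1) x 0 ^ 2) ∧
      -- initial members of the sequence of density matrices
      (∀ x ∈ Icc (0 : ℝ) L, rhoC L 1 x 0 = 1 / L) ∧
      (∀ x ∈ Icc (0 : ℝ) L, rhoC L 2 x 0 =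
        4 / (Real.pi * L) * (Real.pi * (1 / 2 - x / L) * Real.cos (Real.pi * x / L)
          + Real.sin (Real.pi * x / L))) ∧
      -- the rescaled real coefficients
      ∃ rt : ℝ → ℕ → ℝ,
        (∀ x ∈ Icc (0 : ℝ) L, ∀ n : ℕ,
          reflCoeff (φ x) n =
            Complex.exp (Complex.I * Real.pi * (1 - x / L) * n) * (rt x n : ℂ)) ∧
        (∀ x ∈ Icc (0 : ℝ) L, rt x 0 = 1) ∧
        (∀ x ∈ Icc (0 : ℝ) L, rt x 1 = initOne L x) ∧
        -- the difference equation, where its denominators do not vanish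
        (∀ x ∈ Icc (0 : ℝ) L, ∀ N : ℕ, rt x N ≠ 0 → rt x (N + 1) ≠ 0 →
          DiffEq (Real.cos (Real.pi * x / L)) (rt x) N) ∧
        -- the difference equation with denominators cleared, everywhere
        (∀ x ∈ Icc (0 : ℝ) L, ∀ N : ℕ,
          DiffEqCleared (Real.cos (Real.pi * x / L)) (rt x) N) ∧
        -- the equation and the initial values determine the sequence, ...
        (∀ x ∈ Icc (0 : ℝ) L, ∀ N : ℕ, (∀ n ≤ N, rt x n ≠ 0) →
          ∀ s : ℕ → ℝ, s 0 = 1 → s 1 = initOne L x →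
            (∀ n ≤ N, DiffEqCleared (Real.cos (Real.pi * x / L)) s n) →
            ∀ n ≤ N + 2, s n = rt x n) ∧
        -- ... each member being continuous in `x` with only finitely many zeros
        (∀ n : ℕ, ContinuousOn (fun x => rt x n) (Icc (0 : ℝ) L) ∧
          {x ∈ Icc (0 : ℝ) L | rt x n = 0}.Finite) ∧
        -- and the density matrices are then generated recursively
        (∀ x ∈ Icc (0 : ℝ) L, ∀ N : ℕ, 1 ≤ N →
          rhoC L (N + 2) x 0 = (1 - rt x N ^ 2) * rhoC L (N + 1) x 0 ^ 2 / rhoC L N x 0) := by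

  refine ⟨fun x _ => existsUnique_orthonormalSystem L x, fun φ hφ => ?_⟩
  refine ⟨fun x _ N hN => rhoC_pos hL x hN, fun x hx N hN => ?_, fun x _ => rhoC_one hL x,
    fun x hx => rhoC_two hL hx,
    fun x n => verblunsky (cosForm (Real.cos (Real.pi * x / L))) n,
    fun x hx n => reflCoeff_eq (hφ x hx) n, fun x _ => verblunsky_zero,
    fun x hx => verblunsky_one_eq_initOne hL hx, fun x _ N h0 h1 => ?_, fun x _ N => ?_,
    fun x hx N hne s h0 h1 hs => ?_, fun n => ⟨?_, ?_⟩, fun x _ N hN => ?_⟩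
  · have hpos := rhoC_pos hL x (N := N + 1) (by omega)
    rw [norm_reflCoeff (hφ x hx), rhoC_recurrence hL x hN]
    field_simp
  · exact diffEq_of_cleared
      (verblunsky_diffEqCleared (isToeplitzForm_cosForm _) (isPearson_cosForm _) N) h0 h1
  · exact verblunsky_diffEqCleared (isToeplitzForm_cosForm _) (isPearson_cosForm _) N
  · refine eq_of_diffEqCleared (h0.trans verblunsky_zero.symm)
      (h1.trans (verblunsky_one_eq_initOne hL hx).symm)
      (fun n => ((isToeplitzForm_cosForm _).one_sub_verblunsky_sq_pos n).ne')
      (verblunsky_diffEqCleared (isToeplitzForm_cosForm _) (isPearson_cosForm _)) hne hs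
  · exact (continuousOn_verblunsky n).comp (f := fun x => Real.pi * x / L)
      (by fun_prop) fun x hx => mem_Icc_pi hL hx
  -- Finiteness passes from `α` to `x` because `x ↦ πx/L` is injective.
  · have hinj : InjOn (fun x : ℝ => Real.pi * x / L)
        ((fun x : ℝ => Real.pi * x / L) ⁻¹'
          {α ∈ Icc 0 Real.pi | verblunsky (cosForm (Real.cos α)) n = 0}) := by
      intro a _ b _ hab
      have hpi := Real.pi_ne_zero
      have := hL.ne'
      simp only at hab
      field_simp at hab
      exact hab
    exact ((finite_zeros_verblunsky n).preimage hinj).subset fun x hx =>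
      ⟨mem_Icc_pi hL hx.1, hx.2⟩
  · rw [eq_div_iff (rhoC_pos hL x hN).ne']
    exact rhoC_recurrence hL x hN
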